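/- On the complex Hilbert space $L^2(\mathbb R^2)$ let $$H_{La}=\tfrac12\Bigl(-i\nabla-\tfrac{q^{\perp}}{2}\Bigr)^2,\qquad (q_1,q_2)^{\perp}:=(-q_2,q_1),$$ be the Landau Hamiltonian, that is, the closure of this differential operator defined on the Schwartz space $\mathcal S(\mathbb R^2)$ (so that $\mathcal S(\mathbb R^2)$ is an operator core). For $n\in\mathbb N_0=\{0,1,2,\dots\}$ let $P_n$ be the eigenprojection of $H_{La}$ on its $n$-th level, i.e. the orthogonal projection of $L^2(\mathbb R^2)$ onto the eigenspace $\ker\bigl(H_{La}-(n+\tfrac12)\bigr)$. Let $g(q)=\exp\left(-\frac{q^2}{2}\right)$ for $q\in\mathbb R^2$, where $q^2=q_1^2+q_2^2$; $g$ also denotes the bounded operator of multiplication by this function on $L^2(\mathbb R^2)$. Put $\langle a\rangle:=\max(1,|a|)$. Proposition. There is a constant $c>0$ such that for all $n,m\in\mathbb N_0$, in operator norm on $L^2(\mathbb R^2)$, $$\Vert P_n\, g\, P_m\Vert\le\frac{c}{\langle n-m\rangle}.$$ -/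

import Mathlib

open scoped SchwartzMap LineDeriv ENNReal

noncomputable section

namespace Landau

/-- The configuration plane `ℝ²` with its Euclidean norm. -/
abbrev Plane : Type := EuclideanSpace ℝ (Fin 2)

/-- The complex Hilbert space `L²(ℝ²)` (Lebesgue measure). -/
abbrev L2 : Type := MeasureTheory.Lp ℂ 2 (MeasureTheory.volume : MeasureTheory.Measure Plane)

/-- The rotated vector `(q₁, q₂)^⊥ = (-q₂, q₁)`. -/
def perp (q : Plane) : Plane := !₂[-(q 1), q 0]

/-- The vector potential `q^⊥ / 2`, `j`-th component. -/
def vecPot (j : Fin 2) (q : Plane) : ℝ := perp q j / 2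

theorem vecPot_zero (q : Plane) : vecPot 0 q = -(q 1) / 2 := by simp [vecPot, perp]

theorem vecPot_one (q : Plane) : vecPot 1 q = q 0 / 2 := by simp [vecPot, perp]

theorem coord_hasTemperateGrowth (j : Fin 2) :
    Function.HasTemperateGrowth (fun q : Plane => q j) :=
  (EuclideanSpace.proj j : Plane →L[ℝ] ℝ).hasTemperateGrowth

theorem vecPot_hasTemperateGrowth (j : Fin 2) : (vecPot j).HasTemperateGrowth := by
  have h : vecPot j = fun q => (if j = 0 then -(1 / 2) else 1 / 2 : ℝ) * q (1 - j) := by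
    funext q
    fin_cases j <;> simp [vecPot, perp] <;> ring
  rw [h]
  exact (Function.HasTemperateGrowth.const _).mul (coord_hasTemperateGrowth _)

/-- The `j`-th component of the velocity operator `v = -i∇ - q^⊥/2` on Schwartz functions. -/
def velocity (j : Fin 2) : 𝓢(Plane, ℂ) →ₗ[ℂ] 𝓢(Plane, ℂ) :=
  (-Complex.I) • (LineDeriv.lineDerivOpCLM ℂ 𝓢(Plane, ℂ)
      (EuclideanSpace.single j (1 : ℝ)) : 𝓢(Plane, ℂ) →L[ℂ] 𝓢(Plane, ℂ)).toLinearMap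
    - (SchwartzMap.smulLeftCLM (𝕜 := ℂ) ℂ (fun q : Plane => (vecPot j q : ℂ))).toLinearMap

theorem velocity_apply (j : Fin 2) (φ : 𝓢(Plane, ℂ)) (q : Plane) :
    velocity j φ q = -Complex.I * lineDeriv ℝ φ q (EuclideanSpace.single j 1)
      - (vecPot j q : ℂ) * φ q := by
  have h : Function.HasTemperateGrowth (fun q : Plane => (vecPot j q : ℂ)) :=
    Function.HasTemperateGrowth.comp Function.Complex.hasTemperateGrowth_ofReal
      (vecPot_hasTemperateGrowth j)
  simp [velocity, SchwartzMap.smulLeftCLM_apply_apply h, SchwartzMap.lineDerivOp_apply]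

/-- The Landau Hamiltonian `(1/2) (-i∇ - q^⊥/2)²` on Schwartz functions. -/
def schwartzHamiltonian : 𝓢(Plane, ℂ) →ₗ[ℂ] 𝓢(Plane, ℂ) :=
  (1 / 2 : ℂ) • ∑ j : Fin 2, velocity j ∘ₗ velocity j

/-- The inclusion of the Schwartz functions in `L²(ℝ²)`. -/
def incl : 𝓢(Plane, ℂ) →ₗ[ℂ] L2 :=
  (SchwartzMap.toLpCLM ℂ ℂ 2 (MeasureTheory.volume : MeasureTheory.Measure Plane)).toLinearMap

theorem incl_injective : Function.Injective incl :=
  SchwartzMap.injective_toLp 2 _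

/-- The Landau Hamiltonian as an unbounded operator on `L²(ℝ²)` with the Schwartz space as its
domain. -/
def hamiltonianOnSchwartz : L2 →ₗ.[ℂ] L2 where
  domain := LinearMap.range incl
  toFun := incl ∘ₗ schwartzHamiltonian ∘ₗ
    (LinearEquiv.ofInjective incl incl_injective).symm.toLinearMap

theorem mem_domain_hamiltonianOnSchwartz (φ : 𝓢(Plane, ℂ)) :
    incl φ ∈ hamiltonianOnSchwartz.domain := ⟨φ, rfl⟩

theorem hamiltonianOnSchwartz_apply (φ : 𝓢(Plane, ℂ)) :
    hamiltonianOnSchwartz ⟨incl φ, mem_domain_hamiltonianOnSchwartz φ⟩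
      = incl (schwartzHamiltonian φ) := by
  have h : (LinearEquiv.ofInjective incl incl_injective).symm ⟨incl φ, φ, rfl⟩ = φ := by
    rw [LinearEquiv.symm_apply_eq]
    rfl
  exact congrArg (fun ψ => incl (schwartzHamiltonian ψ)) h

theorem inner_incl (φ ψ : 𝓢(Plane, ℂ)) :
    inner ℂ (incl φ) (incl ψ) = ∫ q, ψ q * (starRingEnd ℂ) (φ q) := by
  rw [MeasureTheory.L2.inner_def]
  refine MeasureTheory.integral_congr_ae ?_
  filter_upwards [φ.coeFn_toLp 2 MeasureTheory.volume, ψ.coeFn_toLp 2 MeasureTheory.volume]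
    with q h1 h2
  have e1 : (incl φ : Plane → ℂ) q = φ q := h1
  have e2 : (incl ψ : Plane → ℂ) q = ψ q := h2
  rw [e1, e2]
  exact RCLike.inner_apply _ _

theorem velocity_symm (j : Fin 2) (φ ψ : 𝓢(Plane, ℂ)) :
    inner ℂ (incl (velocity j φ)) (incl ψ) = inner ℂ (incl φ) (incl (velocity j ψ)) := by
  have hT : Function.HasTemperateGrowth (fun q : Plane => (vecPot j q : ℂ)) :=
    Function.HasTemperateGrowth.comp Function.Complex.hasTemperateGrowth_ofReal
      (vecPot_hasTemperateGrowth j)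
  let D : 𝓢(Plane, ℂ) →ₗ[ℂ] 𝓢(Plane, ℂ) := (LineDeriv.lineDerivOpCLM ℂ 𝓢(Plane, ℂ)
      (EuclideanSpace.single j (1 : ℝ)) : 𝓢(Plane, ℂ) →L[ℂ] 𝓢(Plane, ℂ)).toLinearMap
  let M : 𝓢(Plane, ℂ) →ₗ[ℂ] 𝓢(Plane, ℂ) :=
    (SchwartzMap.smulLeftCLM (𝕜 := ℂ) ℂ (fun q : Plane => (vecPot j q : ℂ))).toLinearMap
  have hv : ∀ χ, velocity j χ = (-Complex.I) • D χ - M χ := fun χ => rfl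
  have hD : inner ℂ (incl (D φ)) (incl ψ) = -inner ℂ (incl φ) (incl (D ψ)) := by
    rw [inner_incl, inner_incl]
    have := SchwartzMap.integral_bilinear_lineDerivOp_right_eq_neg_left
      (μ := (MeasureTheory.volume : MeasureTheory.Measure Plane)) φ ψ
      ((ContinuousLinearMap.mul ℝ ℂ).comp (Complex.conjCLE : ℂ →L[ℝ] ℂ))
      (EuclideanSpace.single j (1 : ℝ))
    simp only [ContinuousLinearMap.comp_apply, ContinuousLinearMap.mul_apply',
      ContinuousLinearEquiv.coe_coe, Complex.conjCLE_apply] at this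
    simp only [mul_comm (ψ _), mul_comm (D ψ _)]
    rw [eq_comm, neg_eq_iff_eq_neg]
    exact this
  have hM : inner ℂ (incl (M φ)) (incl ψ) = inner ℂ (incl φ) (incl (M ψ)) := by
    rw [inner_incl, inner_incl]
    congr 1
    ext q
    have e : ∀ χ : 𝓢(Plane, ℂ), M χ q = (vecPot j q : ℂ) * χ q := fun χ =>
      SchwartzMap.smulLeftCLM_apply_apply hT χ q
    rw [e, e, map_mul, Complex.conj_ofReal]
    ring
  rw [hv, hv, map_sub, map_sub, map_smul, map_smul, inner_sub_left, inner_sub_right,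
    inner_smul_left, inner_smul_right, hD, hM]
  simp

theorem schwartzHamiltonian_symm (φ ψ : 𝓢(Plane, ℂ)) :
    inner ℂ (incl (schwartzHamiltonian φ)) (incl ψ)
      = inner ℂ (incl φ) (incl (schwartzHamiltonian ψ)) := by
  simp only [schwartzHamiltonian, LinearMap.smul_apply, LinearMap.sum_apply, LinearMap.comp_apply,
    map_smul, map_sum, inner_smul_left, inner_smul_right, sum_inner, inner_sum, velocity_symm]
  simp [Complex.conj_ofNat]

theorem hamiltonianOnSchwartz_isClosable : hamiltonianOnSchwartz.IsClosable := by
  have hd : Dense (hamiltonianOnSchwartz.domain : Set L2) :=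
    SchwartzMap.denseRange_toLpCLM (F := ℂ)
      (μ := (MeasureTheory.volume : MeasureTheory.Measure Plane)) ENNReal.ofNat_ne_top
  refine LinearPMap.isClosable_iff_exists_closed_extension.2
    ⟨_, LinearPMap.adjoint_isClosed hd, LinearPMap.IsFormalAdjoint.le_adjoint hd ?_⟩
  rintro ⟨_, φ, rfl⟩ ⟨_, ψ, rfl⟩
  have h1 := hamiltonianOnSchwartz_apply φ
  have h2 := hamiltonianOnSchwartz_apply ψ
  exact (congrArg (fun u => inner ℂ u (incl ψ)) h1).trans
    ((schwartzHamiltonian_symm φ ψ).trans (congrArg (fun u => inner ℂ (incl φ) u) h2).symm)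

/-- The Landau Hamiltonian `H_La` on `L²(ℝ²)`: the closure of its restriction to the Schwartz
space, which is thus an operator core. -/
def hamiltonian : L2 →ₗ.[ℂ] L2 := hamiltonianOnSchwartz.closure

/-- The eigenspace of `H_La` for the `n`-th Landau level `n + 1/2`. -/
def levelSpace (n : ℕ) : Submodule ℂ L2 where
  carrier := {f | ∃ hf : f ∈ hamiltonian.domain, hamiltonian ⟨f, hf⟩ = ((n : ℂ) + 1 / 2) • f}
  zero_mem' := ⟨hamiltonian.domain.zero_mem, by
    rw [smul_zero]; exact hamiltonian.map_zero⟩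
  add_mem' := by
    rintro f g ⟨hf, hf'⟩ ⟨hg, hg'⟩
    refine ⟨hamiltonian.domain.add_mem hf hg, ?_⟩
    rw [smul_add, ← hf', ← hg', ← LinearPMap.map_add]
    rfl
  smul_mem' := by
    rintro c f ⟨hf, hf'⟩
    refine ⟨hamiltonian.domain.smul_mem c hf, ?_⟩
    rw [smul_comm, ← hf', ← LinearPMap.map_smul]
    rfl

theorem isClosed_levelSpace (n : ℕ) : IsClosed (levelSpace n : Set L2) := by
  have hcl : IsClosed (hamiltonian.graph : Set (L2 × L2)) :=
    hamiltonianOnSchwartz_isClosable.closure_isClosed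
  have : (levelSpace n : Set L2)
      = (fun f : L2 => (f, ((n : ℂ) + 1 / 2) • f)) ⁻¹' (hamiltonian.graph : Set (L2 × L2)) := by
    ext f
    simp only [Set.mem_preimage, SetLike.mem_coe, LinearPMap.mem_graph_iff]
    constructor
    · rintro ⟨hf, h⟩
      exact ⟨⟨f, hf⟩, rfl, h⟩
    · rintro ⟨⟨y, hy⟩, rfl, h⟩
      exact ⟨hy, h⟩
  rw [this]
  exact hcl.preimage (by fun_prop)

instance levelSpace_completeSpace (n : ℕ) : CompleteSpace (levelSpace n) :=
  (isClosed_levelSpace n).completeSpace_coe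

/-- The eigenprojection `P_n`: the orthogonal projection of `L²(ℝ²)` onto the `n`-th Landau
level. -/
def levelProj (n : ℕ) : L2 →L[ℂ] L2 := (levelSpace n).starProjection

/-- The gaussian `g(q) = exp(-q²/2)`. -/
def gaussian (q : Plane) : ℝ := Real.exp (-‖q‖ ^ 2 / 2)

theorem gaussian_memLp : MeasureTheory.MemLp (fun q : Plane => (gaussian q : ℂ)) ∞
    (MeasureTheory.volume : MeasureTheory.Measure Plane) := by
  refine MeasureTheory.memLp_top_of_bound ?_ 1 (Filter.Eventually.of_forall fun q => ?_)
  · refine Continuous.aestronglyMeasurable ?_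
    unfold gaussian
    fun_prop
  · rw [Complex.norm_real, gaussian, Real.norm_eq_abs, Real.abs_exp, Real.exp_le_one_iff]
    have := sq_nonneg ‖q‖
    linarith

/-- The bounded operator on `L²(ℝ²)` of multiplication by the essentially bounded function `V`. -/
def mulOp (V : Plane → ℂ)
    (hV : MeasureTheory.MemLp V ∞ (MeasureTheory.volume : MeasureTheory.Measure Plane)) :
    L2 →L[ℂ] L2 :=
  (ContinuousLinearMap.mul ℂ ℂ).holderL MeasureTheory.volume ∞ 2 2 (hV.toLp V)

theorem mulOp_apply (V : Plane → ℂ)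
    (hV : MeasureTheory.MemLp V ∞ (MeasureTheory.volume : MeasureTheory.Measure Plane)) (f : L2) :
    ∀ᵐ q : Plane, mulOp V hV f q = V q * f q := by
  filter_upwards [(ContinuousLinearMap.mul ℂ ℂ).coeFn_holder (r := 2) (hV.toLp V) f,
    hV.coeFn_toLp] with q h1 h2
  rw [← h2]
  exact h1

/-- Multiplication by the gaussian `g` on `L²(ℝ²)`. -/
def gaussianOp : L2 →L[ℂ] L2 := mulOp (fun q => (gaussian q : ℂ)) gaussian_memLp

/-- The bracket `⟨a⟩ = max(1, |a|)`. -/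
def bracket (a : ℤ) : ℝ := max 1 |(a : ℝ)|

end Landau

end

noncomputable section

/-! The Landau Hamiltonian is `adag * a + 1/2`. A second oscillator pair `b`, `bdag` commutes with
`a`, `adag` and resolves the degeneracy of each level. The vectors `state n k`, with `n` quanta of
the first kind and `k` of the second, become a Hilbert basis of L² after normalization
(`stateBasis`), and those with first index `n` span the `n`-th level.

The width of `g` is exactly the one for which `a * G = G * bdag` and `b * G = G * adag`. Carrying
the raising operators of the left vector across `g` thus turns ⟨(n,j), g (m,k)⟩ into ⟨vac, g (m+j,
k+n)⟩ (`ip_state_G_state`). By `ip_vac_G_state` this vanishes unless m+j = k+n =: N, and is then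
N!/2^N times the vacuum expectation. After normalization the squared modulus is vacExp² · C(N,n)
C(N,m) / 4^N.

For fixed n and m, the index j determines k, so P_n g P_m is a weighted partial shift between
orthonormal families and its norm is bounded by the supremum of its entries. What remains is C(N,n)
C(N,m) (n-m)² ≤ 2·4^N, uniformly in N (`Nat.choose_mul_choose_mul_sq_sub_le`). It follows from
C(N,n) (N-2n)² ≤ 2N·C(N,N/2) and N·C(N,N/2)² ≤ 4^N. -/

/-! ### Binomial estimates -/

theorem Nat.succ_mul_choose_two_mul_sq_le (M : ℕ) :
    (2 * M + 1) * (2 * M).choose M ^ 2 ≤ 4 ^ (2 * M) := by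
  induction M with
  | zero => simp
  | succ M ih =>
    have h := Nat.succ_mul_centralBinom_succ M
    simp only [Nat.centralBinom] at h
    have h2 : (M + 1) ^ 2 * ((2 * (M + 1) + 1) * (2 * (M + 1)).choose (M + 1) ^ 2)
        ≤ (M + 1) ^ 2 * 4 ^ (2 * (M + 1)) := by
      calc (M + 1) ^ 2 * ((2 * (M + 1) + 1) * (2 * (M + 1)).choose (M + 1) ^ 2)
          = (2 * M + 3) * ((M + 1) * (2 * (M + 1)).choose (M + 1)) ^ 2 := by ring
        _ = 4 * ((2 * M + 3) * (2 * M + 1)) * ((2 * M + 1) * (2 * M).choose M ^ 2) := by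
            rw [h]; ring
        -- (2M+3)(2M+1) = (2M+2)² - 1; the factor 2M+1 in the statement is what makes the induction
        -- close.
        _ ≤ 4 * (4 * (M + 1) ^ 2) * 4 ^ (2 * M) :=
            Nat.mul_le_mul (Nat.mul_le_mul_left _ (by nlinarith)) ih
        _ = (M + 1) ^ 2 * 4 ^ (2 * (M + 1)) := by ring
    exact Nat.le_of_mul_le_mul_left h2 (by positivity)

theorem Nat.mul_choose_half_sq_le (N : ℕ) : N * N.choose (N / 2) ^ 2 ≤ 4 ^ N := by
  rcases Nat.even_or_odd' N with ⟨M, rfl | rfl⟩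
  · have := Nat.succ_mul_choose_two_mul_sq_le M
    rw [Nat.mul_div_cancel_left _ (by norm_num)]
    nlinarith [sq_nonneg ((2 * M).choose M)]
  -- The odd middle coefficient is half of the next even one.
  · have h := Nat.succ_mul_choose_two_mul_sq_le (M + 1)
    have e : (2 * (M + 1)).choose (M + 1) = 2 * (2 * M + 1).choose M := by
      rw [show 2 * (M + 1) = 2 * M + 1 + 1 by ring, Nat.choose_succ_succ,
        ← Nat.choose_symm_of_eq_add (show 2 * M + 1 = M + (M + 1) by ring)]
      ring
    rw [show (2 * M + 1) / 2 = M by omega]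
    rw [e, show 2 * (M + 1) = 2 * M + 1 + 1 by ring, pow_succ 4] at h
    nlinarith [sq_nonneg ((2 * M + 1).choose M)]

/-- The left side increases with n up to the middle, where it is compared with the right side
directly. The summand 4n is what makes it monotone: C(N,n)(N-2n)² alone falls to 0 at n = N/2. The
induction is on x = N-2n, which drops by 2 when n grows by 1. -/
theorem Nat.choose_mul_sq_sub_le_of_two_mul_le (N n : ℕ) (h : 2 * n ≤ N) :
    (N.choose n : ℝ) * (((N : ℝ) - 2 * n) ^ 2 + 4 * n) ≤ 2 * N * N.choose (N / 2) := by
  obtain ⟨x, rfl⟩ := Nat.exists_eq_add_of_le h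
  induction x using Nat.strong_induction_on generalizing n with
  | _ x ih =>
    match x, ih with
    | 0, _ =>
      rw [show (2 * n + 0) / 2 = n by omega]
      push_cast
      apply le_of_eq
      ring
    | 1, _ =>
      rw [show (2 * n + 1) / 2 = n by omega]
      push_cast
      have : (0 : ℝ) ≤ (2 * n + 1).choose n := by positivity
      nlinarith
    | x + 2, ih =>
      have := ih x (by omega) (n + 1) (by omega)
      rw [show 2 * (n + 1) + x = 2 * n + (x + 2) by ring] at this
      refine le_trans ?_ this
      have hc := Nat.choose_succ_right_eq (2 * n + (x + 2)) n
      rw [show 2 * n + (x + 2) - n = n + (x + 2) by omega] at hc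
      have hc' : ((2 * n + (x + 2)).choose (n + 1) : ℝ) * (n + 1)
          = (2 * n + (x + 2)).choose n * (n + (x + 2)) := by exact_mod_cast hc
      have hn : (0 : ℝ) < n + 1 := by positivity
      rw [← mul_le_mul_iff_left₀ hn]
      set A : ℝ := (((2 * n + (x + 2)).choose n : ℕ) : ℝ)
      set B : ℝ := (((2 * n + (x + 2)).choose (n + 1) : ℕ) : ℝ)
      have hA : 0 ≤ A := by positivity
      push_cast
      rw [show B * (((2 : ℝ) * n + (x + 2) - 2 * (n + 1)) ^ 2 + 4 * (n + 1)) * (n + 1)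
        = (B * (n + 1)) * (((2 : ℝ) * n + (x + 2) - 2 * (n + 1)) ^ 2 + 4 * (n + 1)) by ring, hc',
        mul_assoc, mul_assoc]
      refine mul_le_mul_of_nonneg_left ?_ hA
      have hx : (0 : ℝ) ≤ x := by positivity
      have hn' : (0 : ℝ) ≤ n := by positivity
      nlinarith [mul_nonneg hx hx, mul_nonneg (mul_nonneg hx hx) hx, mul_nonneg hx hn',
        mul_nonneg (mul_nonneg hx hx) hn']

theorem Nat.choose_mul_sq_sub_le (N n : ℕ) (h : n ≤ N) :
    (N.choose n : ℝ) * ((N : ℝ) - 2 * n) ^ 2 ≤ 2 * N * N.choose (N / 2) := by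
  wlog hn : 2 * n ≤ N generalizing n
  · have := this (N - n) (by omega) (by omega)
    rw [Nat.choose_symm h, Nat.cast_sub h] at this
    convert this using 2
    ring
  refine le_trans ?_ (Nat.choose_mul_sq_sub_le_of_two_mul_le N n hn)
  gcongr
  linarith [(Nat.cast_nonneg n : (0 : ℝ) ≤ n)]

theorem Nat.choose_mul_choose_mul_sq_sub_le (N n m : ℕ) (hn : n ≤ N) (hm : m ≤ N) :
    (N.choose n : ℝ) * N.choose m * ((n : ℝ) - m) ^ 2 ≤ 2 * 4 ^ N := by
  set C : ℝ := ((N.choose (N / 2) : ℕ) : ℝ)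
  have key : ∀ n m : ℕ, n ≤ N →
      (N.choose n : ℝ) * N.choose m * ((N : ℝ) - 2 * n) ^ 2 ≤ 2 * 4 ^ N := by
    intro n m hn
    have h1 := Nat.choose_mul_sq_sub_le N n hn
    have h2 : (N.choose m : ℝ) ≤ C := Nat.cast_le.2 <| Nat.choose_le_middle m N
    have h3 : (N : ℝ) * C ^ 2 ≤ 4 ^ N := by
      rw [show C = ((N.choose (N / 2) : ℕ) : ℝ) from rfl]
      exact_mod_cast Nat.mul_choose_half_sq_le N
    have hC : 0 ≤ C := by positivity
    calc (N.choose n : ℝ) * N.choose m * ((N : ℝ) - 2 * n) ^ 2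
        = ((N.choose n : ℝ) * ((N : ℝ) - 2 * n) ^ 2) * N.choose m := by ring
      _ ≤ (2 * N * C) * C := by gcongr
      _ = 2 * (N * C ^ 2) := by ring
      _ ≤ _ := by gcongr
  have h1 := key n m hn
  have h2 := key m n hm
  have hp : (0 : ℝ) ≤ N.choose n * N.choose m := by positivity
  -- 2(m-n) is the difference of N-2n and N-2m.
  have : ((n : ℝ) - m) ^ 2 ≤ (((N : ℝ) - 2 * n) ^ 2 + ((N : ℝ) - 2 * m) ^ 2) / 2 := by
    nlinarith [sq_nonneg ((N : ℝ) - 2 * n + (N - 2 * m))]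
  have h3 := mul_le_mul_of_nonneg_left this hp
  nlinarith

theorem Nat.choose_mul_choose_le (N n m : ℕ) :
    (N.choose n : ℝ) * N.choose m ≤ 4 ^ N := by
  have h1 : (N.choose n : ℝ) ≤ 2 ^ N := by exact_mod_cast Nat.choose_le_two_pow N n
  have h2 : (N.choose m : ℝ) ≤ 2 ^ N := by exact_mod_cast Nat.choose_le_two_pow N m
  calc (N.choose n : ℝ) * N.choose m ≤ 2 ^ N * 2 ^ N := by gcongr
    _ = 4 ^ N := by rw [← mul_pow]; norm_num

/-! ### Gaussians as Schwartz functions -/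

theorem Real.one_add_pow_mul_exp_neg_mul_sq_le {c : ℝ} (hc : 0 < c) (p : ℕ) (t : ℝ) (ht : 0 ≤ t) :
    (1 + t) ^ p * Real.exp (-c * t ^ 2) ≤ p.factorial * Real.exp (1 + 1 / (4 * c)) := by
  have h1 : (1 + t) ^ p ≤ p.factorial * Real.exp (1 + t) := by
    have := Real.pow_div_factorial_le_exp (1 + t) (by positivity) p
    rwa [div_le_iff₀' (by positivity)] at this
  calc (1 + t) ^ p * Real.exp (-c * t ^ 2)
      ≤ p.factorial * Real.exp (1 + t) * Real.exp (-c * t ^ 2) := by gcongr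
    _ = p.factorial * Real.exp (1 + t - c * t ^ 2) := by
        rw [mul_assoc, ← Real.exp_add]
        ring_nf
    _ ≤ _ := by
        gcongr
        have : 1 + 1 / (4 * c) - (1 + t - c * t ^ 2) = (2 * c * t - 1) ^ 2 / (4 * c) := by
          field_simp
          ring
        have h2 : 0 ≤ (2 * c * t - 1) ^ 2 / (4 * c) := by positivity
        linarith

/-- The function `exp (-c ‖x‖²)`, for `c > 0`, as a Schwartz function. -/
def SchwartzMap.expNegMulNormSq {E : Type*} [NormedAddCommGroup E] [InnerProductSpace ℝ E]
    (c : ℝ) (hc : 0 < c) : 𝓢(E, ℝ) where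
  toFun x := Real.exp (-c * ‖x‖ ^ 2)
  smooth' := Real.contDiff_exp.comp (contDiff_const.mul (contDiff_norm_sq ℝ))
  decay' k n := by
    have hT : Function.HasTemperateGrowth (fun x : E => -c * ‖x‖ ^ 2) :=
      (Function.HasTemperateGrowth.const _).mul (Function.hasTemperateGrowth_norm_sq E)
    obtain ⟨l, K, hK, hb⟩ := hT.norm_iteratedFDeriv_le_uniform n
    refine ⟨n.factorial * (K + 1) ^ n *
      ((k + l * n).factorial * Real.exp (1 + 1 / (4 * c))), fun x => ?_⟩
    have h1 : (1 : ℝ) ≤ 1 + ‖x‖ := by linarith [norm_nonneg x]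
    -- `norm_iteratedFDeriv_comp_le` wants the `i`-th derivative bounded by `D ^ i`; taking `K + 1`
    -- instead of `K` gives 1 ≤ D, hence D ≤ D^i for i ≥ 1.
    have hD : (1 : ℝ) ≤ (K + 1) * (1 + ‖x‖) ^ l :=
      one_le_mul_of_one_le_of_one_le (by linarith) (one_le_pow₀ h1)
    have h := norm_iteratedFDeriv_comp_le (𝕜 := ℝ) (g := Real.exp)
      (f := fun x : E => -c * ‖x‖ ^ 2) (n := n) (N := (n : WithTop ℕ∞)) Real.contDiff_exp
      (contDiff_const.mul (contDiff_norm_sq ℝ)) le_rfl x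
      (C := Real.exp (-c * ‖x‖ ^ 2)) (D := (K + 1) * (1 + ‖x‖) ^ l)
      (fun i _ => by
        rw [norm_iteratedFDeriv_eq_norm_iteratedDeriv, iteratedDeriv_eq_iterate,
          Real.iter_deriv_exp, Real.norm_eq_abs, Real.abs_exp])
      (fun i hi hi' => (hb i hi' x).trans <| by
        refine le_trans ?_ (le_self_pow₀ hD (by omega))
        gcongr
        linarith)
    calc ‖x‖ ^ k * ‖iteratedFDeriv ℝ n (fun x : E => Real.exp (-c * ‖x‖ ^ 2)) x‖
        ≤ (1 + ‖x‖) ^ k * (n.factorial * Real.exp (-c * ‖x‖ ^ 2) *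
            ((K + 1) * (1 + ‖x‖) ^ l) ^ n) := by
          gcongr
          · linarith
          · exact h
      _ = n.factorial * (K + 1) ^ n *
            ((1 + ‖x‖) ^ (k + l * n) * Real.exp (-c * ‖x‖ ^ 2)) := by
          rw [mul_pow, ← pow_mul, pow_add]
          ring
      _ ≤ _ := mul_le_mul_of_nonneg_left
          (Real.one_add_pow_mul_exp_neg_mul_sq_le hc _ _ (norm_nonneg x)) (by positivity)

namespace Landau

/-- The function `exp (-c ‖q‖²)` as a complex Schwartz function on the plane. -/
def expSq (c : ℝ) (hc : 0 < c) : 𝓢(Plane, ℂ) :=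
  SchwartzMap.postcompCLM Complex.ofRealCLM (SchwartzMap.expNegMulNormSq c hc)

theorem expSq_apply (c : ℝ) (hc : 0 < c) (q : Plane) :
    expSq c hc q = (Real.exp (-c * ‖q‖ ^ 2) : ℂ) := rfl

/-! ### Derivatives, coordinates and the gaussian as operators on Schwartz functions -/

theorem gaussian_hasTemperateGrowth :
    Function.HasTemperateGrowth (fun q : Plane => (gaussian q : ℂ)) := by
  have h := (expSq (1 / 2) (by norm_num)).hasTemperateGrowth
  convert h using 2 with q
  rw [expSq_apply, gaussian]
  congr 2
  ring

theorem coordC_hasTemperateGrowth (j : Fin 2) :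
    Function.HasTemperateGrowth (fun q : Plane => ((q j : ℝ) : ℂ)) :=
  Function.HasTemperateGrowth.comp Function.Complex.hasTemperateGrowth_ofReal
    (coord_hasTemperateGrowth j)

/-- The derivative in the `j`-th coordinate direction. -/
def D (j : Fin 2) : Module.End ℂ 𝓢(Plane, ℂ) :=
  (LineDeriv.lineDerivOpCLM ℂ 𝓢(Plane, ℂ)
      (EuclideanSpace.single j (1 : ℝ)) : 𝓢(Plane, ℂ) →L[ℂ] 𝓢(Plane, ℂ)).toLinearMap

/-- Multiplication by the `j`-th coordinate. -/
def X (j : Fin 2) : Module.End ℂ 𝓢(Plane, ℂ) :=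
  (SchwartzMap.smulLeftCLM (𝕜 := ℂ) ℂ (fun q : Plane => ((q j : ℝ) : ℂ))).toLinearMap

/-- Multiplication by the gaussian on Schwartz functions. -/
def G : Module.End ℂ 𝓢(Plane, ℂ) :=
  (SchwartzMap.smulLeftCLM (𝕜 := ℂ) ℂ (fun q : Plane => (gaussian q : ℂ))).toLinearMap

theorem D_apply (j : Fin 2) (φ : 𝓢(Plane, ℂ)) (q : Plane) :
    D j φ q = fderiv ℝ φ q (EuclideanSpace.single j 1) :=
  SchwartzMap.lineDerivOp_apply_eq_fderiv _ _ _

theorem X_apply (j : Fin 2) (φ : 𝓢(Plane, ℂ)) (q : Plane) : X j φ q = (q j : ℂ) * φ q :=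
  SchwartzMap.smulLeftCLM_apply_apply (coordC_hasTemperateGrowth j) φ q

theorem G_apply (φ : 𝓢(Plane, ℂ)) (q : Plane) : G φ q = (gaussian q : ℂ) * φ q :=
  SchwartzMap.smulLeftCLM_apply_apply gaussian_hasTemperateGrowth φ q

theorem hasFDerivAt_coord (j : Fin 2) (q : Plane) :
    HasFDerivAt (fun q : Plane => ((q j : ℝ) : ℂ))
      (Complex.ofRealCLM ∘L (EuclideanSpace.proj j : Plane →L[ℝ] ℝ)) q :=
  (Complex.ofRealCLM ∘L (EuclideanSpace.proj j : Plane →L[ℝ] ℝ)).hasFDerivAt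

theorem hasFDerivAt_exp_sq (c : ℝ) (q : Plane) :
    HasFDerivAt (fun q : Plane => (Real.exp (-c * ‖q‖ ^ 2) : ℂ))
      (Complex.ofRealCLM ∘L (Real.exp (-c * ‖q‖ ^ 2) • (-c) • (2 • innerSL ℝ q))) q :=
  (Complex.ofRealCLM.hasFDerivAt (x := Real.exp (-c * ‖q‖ ^ 2))).comp q
    (((hasStrictFDerivAt_norm_sq q).hasFDerivAt.const_mul (-c)).exp)

theorem fderiv_exp_sq_single (c : ℝ) (q : Plane) (j : Fin 2) :
    fderiv ℝ (fun q : Plane => (Real.exp (-c * ‖q‖ ^ 2) : ℂ)) q (EuclideanSpace.single j 1)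
      = -(2 * c) * q j * Real.exp (-c * ‖q‖ ^ 2) := by
  rw [(hasFDerivAt_exp_sq c q).fderiv]
  simp only [ContinuousLinearMap.comp_apply, _root_.smul_apply, innerSL_apply_apply,
    EuclideanSpace.inner_single_right, Complex.ofRealCLM_apply, smul_eq_mul]
  simp
  ring

theorem D_X (j k : Fin 2) : D j * X k = X k * D j + (if j = k then 1 else 0) := by
  ext φ q
  have h := ((hasFDerivAt_coord k q).mul (φ.hasFDerivAt q)).fderiv
  have e : (X k φ : Plane → ℂ) = (fun q : Plane => ((q k : ℝ) : ℂ)) * φ :=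
    funext fun q => X_apply k φ q
  rw [Module.End.mul_apply, D_apply, e, h]
  by_cases hjk : j = k
  · subst hjk
    simp [X_apply, D_apply]
  · simp [X_apply, D_apply, hjk, Ne.symm hjk]

theorem D_D (j k : Fin 2) : D j * D k = D k * D j := by
  ext φ q
  have e : ∀ k : Fin 2, (D k φ : Plane → ℂ) = fun q => fderiv ℝ φ q (EuclideanSpace.single k 1) :=
    fun k => funext fun q => D_apply k φ q
  have hd : DifferentiableAt ℝ (fderiv ℝ φ) q :=
    ((φ.smooth 2).fderiv_right (m := 1) (by norm_num)).differentiable (by norm_num) q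
  have h2 : ∀ j k : Fin 2, (D j * D k) φ q
      = fderiv ℝ (fderiv ℝ φ) q (EuclideanSpace.single j 1) (EuclideanSpace.single k 1) := by
    intro j k
    rw [Module.End.mul_apply, D_apply, e, fderiv_clm_apply hd (differentiableAt_const _)]
    simp
  rw [h2, h2]
  exact ((φ.smooth 2).contDiffAt.isSymmSndFDerivAt (by simp)) _ _

theorem X_X (j k : Fin 2) : X j * X k = X k * X j := by
  ext φ q
  simp only [Module.End.mul_apply, X_apply]
  ring

theorem X_G (j : Fin 2) : X j * G = G * X j := by
  ext φ q
  simp only [Module.End.mul_apply, X_apply, G_apply]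
  ring

theorem D_G (j : Fin 2) : D j * G = G * D j - G * X j := by
  ext φ q
  have e : (G φ : Plane → ℂ) = (fun q : Plane => (Real.exp (-(1 / 2) * ‖q‖ ^ 2) : ℂ)) * φ := by
    funext q
    rw [G_apply, gaussian, Pi.mul_apply]
    congr 3
    ring
  have hg : (gaussian q : ℂ) = (Real.exp (-(1 / 2) * ‖q‖ ^ 2) : ℂ) := by
    rw [gaussian]
    congr 2
    ring
  have hd : DifferentiableAt ℝ (fun q : Plane => (Real.exp (-(1 / 2) * ‖q‖ ^ 2) : ℂ)) q :=
    (hasFDerivAt_exp_sq (1 / 2) q).differentiableAt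
  rw [Module.End.mul_apply, D_apply, e, fderiv_mul hd (φ.differentiableAt), LinearMap.sub_apply,
    _root_.sub_apply, Module.End.mul_apply, Module.End.mul_apply, G_apply, G_apply, X_apply,
    D_apply, hg]
  simp only [_root_.add_apply, _root_.smul_apply, fderiv_exp_sq_single]
  simp
  ring

theorem D_expSq (j : Fin 2) : D j (expSq (1 / 4) (by norm_num))
    = (-(1 / 2) : ℂ) • X j (expSq (1 / 4) (by norm_num)) := by
  ext q
  have e : (expSq (1 / 4) (by norm_num) : Plane → ℂ)
      = fun q : Plane => (Real.exp (-(1 / 4) * ‖q‖ ^ 2) : ℂ) := rfl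
  rw [D_apply, e, fderiv_exp_sq_single, _root_.smul_apply, X_apply, expSq_apply]
  push_cast
  rw [smul_eq_mul]
  ring

theorem velocity_zero : velocity 0 = (-Complex.I) • D 0 + (1 / 2 : ℂ) • X 1 := by
  ext φ q
  have : lineDeriv ℝ φ q (EuclideanSpace.single 0 1) = D 0 φ q :=
    (SchwartzMap.lineDerivOp_apply _ _ _).symm
  rw [velocity_apply, vecPot_zero, this]
  simp [X_apply]
  ring

theorem velocity_one : velocity 1 = (-Complex.I) • D 1 - (1 / 2 : ℂ) • X 0 := by
  ext φ q
  have : lineDeriv ℝ φ q (EuclideanSpace.single 1 1) = D 1 φ q :=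
    (SchwartzMap.lineDerivOp_apply _ _ _).symm
  rw [velocity_apply, vecPot_one, this]
  simp [X_apply]
  ring

theorem inner_X (j : Fin 2) (φ ψ : 𝓢(Plane, ℂ)) :
    inner ℂ (incl (X j φ)) (incl ψ) = inner ℂ (incl φ) (incl (X j ψ)) := by
  rw [inner_incl, inner_incl]
  congr 1
  ext q
  rw [X_apply, X_apply, map_mul, Complex.conj_ofReal]
  ring

theorem gaussianOp_incl (φ : 𝓢(Plane, ℂ)) : gaussianOp (incl φ) = incl (G φ) := by
  apply MeasureTheory.Lp.ext
  filter_upwards [mulOp_apply _ gaussian_memLp (incl φ), φ.coeFn_toLp 2 MeasureTheory.volume,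
    (G φ).coeFn_toLp 2 MeasureTheory.volume] with q h1 h2 h3
  have e2 : (incl φ : Plane → ℂ) q = φ q := h2
  have e3 : (incl (G φ) : Plane → ℂ) q = G φ q := h3
  rw [e3, G_apply, ← e2]
  exact h1

/-! ### Ladder operators and their commutation relations -/

/-- The scalar `1 / √2`. -/
def s : ℂ := ((√2)⁻¹ : ℝ)

theorem s_mul_s : s * s = 1 / 2 := by
  rw [s, ← Complex.ofReal_mul, ← mul_inv, Real.mul_self_sqrt (by norm_num)]
  norm_num

theorem conj_s : (starRingEnd ℂ) s = s := Complex.conj_ofReal _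

/-- The commutator of two ring elements. -/
def comm {R : Type*} [Ring R] (x y : R) : R := x * y - y * x

section comm

variable {R : Type*} [Ring R] (x y z : R)

theorem comm_add_left : comm (x + y) z = comm x z + comm y z := by
  simp only [comm, add_mul, mul_add]
  abel

theorem comm_add_right : comm x (y + z) = comm x y + comm x z := by
  simp only [comm, add_mul, mul_add]
  abel

theorem comm_sub_left : comm (x - y) z = comm x z - comm y z := by
  simp only [comm, sub_mul, mul_sub]
  abel

theorem comm_sub_right : comm x (y - z) = comm x y - comm x z := by
  simp only [comm, sub_mul, mul_sub]
  abel

theorem comm_smul_left [Algebra ℂ R] (c : ℂ) : comm (c • x) y = c • comm x y := by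
  simp only [comm, smul_mul_assoc, mul_smul_comm, smul_sub]

theorem comm_smul_right [Algebra ℂ R] (c : ℂ) : comm x (c • y) = c • comm x y := by
  simp only [comm, smul_mul_assoc, mul_smul_comm, smul_sub]

theorem comm_self : comm x x = 0 := sub_self _

theorem comm_swap : comm x y = -comm y x := (neg_sub _ _).symm

end comm

/-- The lowering operator of the Landau levels. -/
def a : Module.End ℂ 𝓢(Plane, ℂ) := s • (velocity 0 + Complex.I • velocity 1)

/-- The raising operator of the Landau levels. -/
def adag : Module.End ℂ 𝓢(Plane, ℂ) := s • (velocity 0 - Complex.I • velocity 1)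

/-- Multiplication by `i (q₁ - i q₂) / √2`. -/
def Z : Module.End ℂ 𝓢(Plane, ℂ) := (Complex.I * s) • (X 0 - Complex.I • X 1)

/-- Multiplication by `-i (q₁ + i q₂) / √2`. -/
def Zdag : Module.End ℂ 𝓢(Plane, ℂ) := (-(Complex.I * s)) • (X 0 + Complex.I • X 1)

/-- The lowering operator of the guiding centre. -/
def b : Module.End ℂ 𝓢(Plane, ℂ) := adag - Z

/-- The raising operator of the guiding centre. -/
def bdag : Module.End ℂ 𝓢(Plane, ℂ) := a - Zdag

theorem comm_D_X (j k : Fin 2) : comm (D j) (X k) = if j = k then 1 else 0 := by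
  rw [comm, D_X, add_sub_cancel_left]

theorem comm_X_D (j k : Fin 2) : comm (X j) (D k) = -(if k = j then 1 else 0) := by
  rw [comm_swap (X j), comm_D_X]

theorem comm_D_D (j k : Fin 2) : comm (D j) (D k) = 0 := by
  rw [comm, D_D, sub_self]

theorem comm_X_X (j k : Fin 2) : comm (X j) (X k) = 0 := by
  rw [comm, X_X, sub_self]

theorem comm_D_G (j : Fin 2) : comm (D j) G = -(G * X j) := by
  rw [comm, D_G]
  abel

theorem comm_X_G (j : Fin 2) : comm (X j) G = 0 := by
  rw [comm, X_G, sub_self]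

theorem comm_a_adag : comm a adag = 1 := by
  simp only [a, adag, velocity_zero, velocity_one, comm_add_right, comm_sub_right, comm_add_left,
    comm_sub_left, comm_smul_left,
    comm_smul_right, comm_D_X, comm_X_D, comm_D_D, comm_X_X]
  simp only [if_true, Fin.isValue, zero_ne_one, one_ne_zero, if_false]
  have h := s_mul_s
  match_scalars
  linear_combination (-2 * Complex.I ^ 2) * h - Complex.I_sq

theorem comm_a_Z : comm a Z = 1 := by
  simp only [a, Z, velocity_zero, velocity_one, comm_sub_right, comm_add_left, comm_sub_left,
    comm_smul_left,
    comm_smul_right, comm_D_X, comm_X_X]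
  simp only [if_true, Fin.isValue, zero_ne_one, one_ne_zero, if_false]
  have h := s_mul_s
  match_scalars
  linear_combination (-2 * Complex.I ^ 2) * h - Complex.I_sq
    + (s * s * Complex.I ^ 2) * Complex.I_sq

theorem comm_a_Zdag : comm a Zdag = 0 := by
  simp only [a, Zdag, velocity_zero, velocity_one, comm_add_right, comm_add_left, comm_sub_left,
    comm_smul_left,
    comm_smul_right, comm_D_X, comm_X_X]
  simp only [if_true, Fin.isValue, zero_ne_one, one_ne_zero, if_false]
  match_scalars
  linear_combination (s * s * Complex.I ^ 2) * Complex.I_sq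

theorem comm_adag_Z : comm adag Z = 0 := by
  simp only [adag, Z, velocity_zero, velocity_one, comm_sub_right, comm_add_left, comm_sub_left,
    comm_smul_left,
    comm_smul_right, comm_D_X, comm_X_X]
  simp only [if_true, Fin.isValue, zero_ne_one, one_ne_zero, if_false]
  match_scalars
  linear_combination (-(s * s * Complex.I ^ 2)) * Complex.I_sq

theorem comm_adag_Zdag : comm adag Zdag = -1 := by
  simp only [adag, Zdag, velocity_zero, velocity_one, comm_add_right, comm_add_left,
    comm_sub_left, comm_smul_left,
    comm_smul_right, comm_D_X, comm_X_X]
  simp only [if_true, Fin.isValue, zero_ne_one, one_ne_zero, if_false]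
  have h := s_mul_s
  match_scalars
  linear_combination (2 * Complex.I ^ 2) * h + Complex.I_sq - (s * s * Complex.I ^ 2) * Complex.I_sq

theorem comm_Z_Zdag : comm Z Zdag = 0 := by
  simp only [Z, Zdag, comm_add_right, comm_sub_left, comm_smul_left, comm_smul_right, comm_X_X]
  simp

theorem comm_a_bdag : comm a bdag = 0 := by
  rw [bdag, comm_sub_right, comm_self, comm_a_Zdag, sub_self]

theorem comm_b_adag : comm b adag = 0 := by
  rw [b, comm_sub_left, comm_self, comm_swap Z, comm_adag_Z, neg_zero, sub_self]

theorem comm_adag_bdag : comm adag bdag = 0 := by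
  rw [bdag, comm_sub_right, comm_adag_Zdag, comm_swap adag, comm_a_adag, sub_self]

theorem comm_b_bdag : comm b bdag = 1 := by
  rw [b, bdag, comm_sub_left, comm_sub_right, comm_sub_right, comm_adag_Zdag, comm_Z_Zdag,
    comm_swap adag, comm_a_adag,
    comm_swap Z, comm_a_Z]
  abel

theorem comm_Z_G : comm Z G = 0 := by
  simp only [Z, comm_sub_left, comm_smul_left, comm_X_G, smul_zero, sub_zero]

theorem comm_Zdag_G : comm Zdag G = 0 := by
  simp only [Zdag, comm_add_left, comm_smul_left, comm_X_G, smul_zero, add_zero]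

theorem comm_a_G : comm a G = -(G * Zdag) := by
  simp only [a, Zdag, velocity_zero, velocity_one, comm_add_left, comm_sub_left, comm_smul_left,
    comm_X_G, comm_D_G,
    mul_add, mul_smul_comm]
  match_scalars <;> ring_nf

theorem comm_adag_G : comm adag G = G * Z := by
  simp only [adag, Z, velocity_zero, velocity_one, comm_add_left, comm_sub_left, comm_smul_left,
    comm_X_G, comm_D_G,
    mul_sub, mul_smul_comm]
  match_scalars <;> ring_nf

/-- Differentiating `g` produces a multiple of a coordinate, so commuting `a` past `G` subtracts
`Zdag`, which is precisely the difference between `a` and `bdag`. This uses the exact width of the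
gaussian. -/
theorem a_mul_G : a * G = G * bdag := by
  have h := comm_a_G
  rw [comm, sub_eq_iff_eq_add] at h
  rw [h, bdag, mul_sub]
  abel

theorem b_mul_G : b * G = G * adag := by
  have h := comm_adag_G
  have h2 := comm_Z_G
  rw [comm, sub_eq_iff_eq_add] at h
  rw [comm, sub_eq_zero] at h2
  rw [b, sub_mul, h, h2]
  abel

theorem adag_mul_G : adag * G = G * ((2 : ℂ) • adag - b) := by
  have h := comm_adag_G
  rw [comm, sub_eq_iff_eq_add] at h
  rw [h, b, ← mul_add]
  congr 1
  module

theorem bdag_mul_G : bdag * G = G * ((2 : ℂ) • bdag - a) := by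
  have h := comm_a_G
  have h2 := comm_Zdag_G
  rw [comm, sub_eq_iff_eq_add] at h
  rw [comm, sub_eq_zero] at h2
  rw [bdag, sub_mul, h, h2, ← mul_neg, ← mul_add, ← mul_sub]
  congr 1
  module

/-- Expanding `adag * a` gives half the sum of the squared velocities plus (i/2)[v₀, v₁], and [v₀,
v₁] = i is the constant magnetic field. -/
theorem schwartzHamiltonian_eq : schwartzHamiltonian = adag * a + (1 / 2 : ℂ) • 1 := by
  have h : comm (velocity 0) (velocity 1) = Complex.I • (1 : Module.End ℂ 𝓢(Plane, ℂ)) := by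
    simp only [velocity_zero, velocity_one, comm_sub_right, comm_add_left, comm_smul_left,
      comm_smul_right, comm_D_X, comm_X_D, comm_D_D, comm_X_X]
    simp only [if_true]
    match_scalars
    ring
  rw [comm, sub_eq_iff_eq_add] at h
  have e : schwartzHamiltonian
      = (1 / 2 : ℂ) • (velocity 0 * velocity 0 + velocity 1 * velocity 1) := by
    rw [schwartzHamiltonian, Fin.sum_univ_two]
    rfl
  rw [e, adag, a, smul_mul_smul_comm, s_mul_s]
  simp only [sub_mul, mul_add, mul_smul_comm, smul_mul_assoc, h]
  match_scalars
  all_goals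
    first
    | ring1
    | linear_combination (-1 / 2 : ℂ) * Complex.I_sq
    | linear_combination (1 / 2 : ℂ) * Complex.I_sq

theorem inner_a (φ ψ : 𝓢(Plane, ℂ)) :
    inner ℂ (incl (adag φ)) (incl ψ) = inner ℂ (incl φ) (incl (a ψ)) := by
  simp only [a, adag, LinearMap.smul_apply, LinearMap.sub_apply, LinearMap.add_apply, map_smul,
    map_sub, map_add, inner_smul_left, inner_smul_right, inner_sub_left, inner_add_right,
    velocity_symm, conj_s, Complex.conj_I]
  ring

theorem inner_adag (φ ψ : 𝓢(Plane, ℂ)) :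
    inner ℂ (incl (a φ)) (incl ψ) = inner ℂ (incl φ) (incl (adag ψ)) := by
  rw [← inner_conj_symm, ← inner_a, inner_conj_symm]

theorem inner_Z (φ ψ : 𝓢(Plane, ℂ)) :
    inner ℂ (incl (Zdag φ)) (incl ψ) = inner ℂ (incl φ) (incl (Z ψ)) := by
  simp only [Z, Zdag, LinearMap.smul_apply, LinearMap.sub_apply, LinearMap.add_apply, map_smul,
    map_sub, map_add, inner_smul_left, inner_smul_right, inner_add_left, inner_sub_right,
    inner_X, conj_s, Complex.conj_I, map_neg, map_mul]
  ring

theorem inner_b (φ ψ : 𝓢(Plane, ℂ)) :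
    inner ℂ (incl (bdag φ)) (incl ψ) = inner ℂ (incl φ) (incl (b ψ)) := by
  rw [b, bdag, LinearMap.sub_apply, LinearMap.sub_apply, map_sub, map_sub, inner_sub_left,
    inner_sub_right, inner_adag, inner_Z]

theorem inner_bdag (φ ψ : 𝓢(Plane, ℂ)) :
    inner ℂ (incl (b φ)) (incl ψ) = inner ℂ (incl φ) (incl (bdag ψ)) := by
  rw [← inner_conj_symm, ← inner_b, inner_conj_symm]

/-! ### The vacuum and the joint eigenstates -/

/-- The unnormalized ground state `exp (-q² / 4)`. -/
def ground : 𝓢(Plane, ℂ) := expSq (1 / 4) (by norm_num)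

theorem D_ground (j : Fin 2) : D j ground = (-(1 / 2) : ℂ) • X j ground := D_expSq j

theorem a_ground : a ground = 0 := by
  simp only [a, velocity_zero, velocity_one, LinearMap.smul_apply, LinearMap.add_apply,
    LinearMap.sub_apply, D_ground]
  match_scalars <;> first | ring1 | linear_combination (s / 2) * Complex.I_sq

theorem b_ground : b ground = 0 := by
  simp only [b, adag, Z, velocity_zero, velocity_one, LinearMap.smul_apply, LinearMap.add_apply,
    LinearMap.sub_apply, D_ground]
  match_scalars <;> first | ring1 | linear_combination (s / 2) * Complex.I_sq

/-- The normalized vacuum. -/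
def vac : 𝓢(Plane, ℂ) := ((‖incl ground‖⁻¹ : ℝ) : ℂ) • ground

theorem ground_ne_zero : ground ≠ 0 := by
  intro h
  have := congrArg (fun φ : 𝓢(Plane, ℂ) => φ 0) h
  simp [ground, expSq_apply] at this

theorem norm_vac : ‖incl vac‖ = 1 := by
  have : ‖incl ground‖ ≠ 0 := by
    rw [norm_ne_zero_iff]
    exact fun h => ground_ne_zero (incl_injective (h.trans (map_zero incl).symm))
  rw [vac, map_smul, norm_smul, Complex.norm_real, norm_inv, norm_norm, inv_mul_cancel₀ this]

theorem a_vac : a vac = 0 := by rw [vac, map_smul, a_ground, smul_zero]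

theorem b_vac : b vac = 0 := by rw [vac, map_smul, b_ground, smul_zero]

/-- The unnormalized state with `n` quanta in the Landau level and `k` quanta in the guiding
centre. -/
def state (n k : ℕ) : 𝓢(Plane, ℂ) := (adag ^ n) ((bdag ^ k) vac)

theorem adag_state (n k : ℕ) : adag (state n k) = state (n + 1) k := by
  rw [state, state, pow_succ', Module.End.mul_apply]

theorem comm_eq_zero_iff {R : Type*} [Ring R] {x y : R} : comm x y = 0 ↔ Commute x y :=
  sub_eq_zero

theorem bdag_state (n k : ℕ) : bdag (state n k) = state n (k + 1) := by
  have h : Commute bdag (adag ^ n) := (comm_eq_zero_iff.1 comm_adag_bdag).symm.pow_right n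
  rw [state, state, pow_succ', Module.End.mul_apply, ← Module.End.mul_apply, h.eq,
    Module.End.mul_apply]

/-- Commutation with x acts as the derivative d/dy on powers of y. -/
theorem comm_pow_succ {R : Type*} [Ring R] {x y : R} (h : comm x y = 1) (n : ℕ) :
    x * y ^ (n + 1) = y ^ (n + 1) * x + (n + 1 : R) * y ^ n := by
  rw [comm, sub_eq_iff_eq_add] at h
  induction n with
  | zero => simp [h, add_comm]
  | succ n ih =>
    rw [pow_succ y (n + 1), ← mul_assoc, ih, add_mul, mul_assoc, h, mul_add, mul_one, mul_assoc,
      ← pow_succ]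
    push_cast
    noncomm_ring

theorem natCast_end_apply (n : ℕ) (φ : 𝓢(Plane, ℂ)) :
    ((n : Module.End ℂ 𝓢(Plane, ℂ)) + 1) φ = ((n : ℂ) + 1) • φ := by
  rw [LinearMap.add_apply, Module.End.natCast_apply, Module.End.one_apply, add_smul, one_smul,
    Nat.cast_smul_eq_nsmul]

theorem a_bdag_pow_vac (k : ℕ) : a ((bdag ^ k) vac) = 0 := by
  have h : Commute a (bdag ^ k) := (comm_eq_zero_iff.1 comm_a_bdag).pow_right k
  rw [← Module.End.mul_apply, h.eq, Module.End.mul_apply, a_vac, map_zero]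

theorem a_state_zero (k : ℕ) : a (state 0 k) = 0 := by
  rw [state, pow_zero, Module.End.one_apply, a_bdag_pow_vac]

theorem a_state_succ (n k : ℕ) : a (state (n + 1) k) = ((n : ℂ) + 1) • state n k := by
  rw [state, ← Module.End.mul_apply, comm_pow_succ comm_a_adag, LinearMap.add_apply,
    Module.End.mul_apply, a_bdag_pow_vac, map_zero, zero_add, Module.End.mul_apply,
    natCast_end_apply, state]

theorem b_adag_pow (n : ℕ) (φ : 𝓢(Plane, ℂ)) : b ((adag ^ n) φ) = (adag ^ n) (b φ) := by
  have h : Commute b (adag ^ n) := (comm_eq_zero_iff.1 comm_b_adag).pow_right n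
  rw [← Module.End.mul_apply, h.eq, Module.End.mul_apply]

theorem b_state_zero (n : ℕ) : b (state n 0) = 0 := by
  rw [state, b_adag_pow, pow_zero, Module.End.one_apply, b_vac, map_zero]

theorem b_state_succ (n k : ℕ) : b (state n (k + 1)) = ((k : ℂ) + 1) • state n k := by
  rw [state, b_adag_pow, ← Module.End.mul_apply b, comm_pow_succ comm_b_bdag, LinearMap.add_apply,
    Module.End.mul_apply, b_vac, map_zero, zero_add, Module.End.mul_apply, natCast_end_apply,
    map_smul, state]

theorem schwartzHamiltonian_state (n k : ℕ) :
    schwartzHamiltonian (state n k) = ((n : ℂ) + 1 / 2) • state n k := by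
  rw [schwartzHamiltonian_eq, LinearMap.add_apply, Module.End.mul_apply, LinearMap.smul_apply,
    Module.End.one_apply, add_smul]
  congr 1
  cases n with
  | zero => rw [a_state_zero, map_zero, Nat.cast_zero, zero_smul]
  | succ n => rw [a_state_succ, map_smul, adag_state, Nat.cast_succ]

/-! ### Matrix elements of the gaussian between states -/

/-- The inner product of two Schwartz functions in `L²`. -/
def ip (φ ψ : 𝓢(Plane, ℂ)) : ℂ := inner ℂ (incl φ) (incl ψ)

theorem ip_smul_right (c : ℂ) (φ ψ : 𝓢(Plane, ℂ)) : ip φ (c • ψ) = c * ip φ ψ := by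
  rw [ip, map_smul, inner_smul_right, ip]

theorem ip_sub_right (φ ψ χ : 𝓢(Plane, ℂ)) : ip φ (ψ - χ) = ip φ ψ - ip φ χ := by
  rw [ip, map_sub, inner_sub_right, ip, ip]

theorem ip_zero_left (φ : 𝓢(Plane, ℂ)) : ip 0 φ = 0 := by
  rw [ip, map_zero, inner_zero_left]

theorem ip_zero_right (φ : 𝓢(Plane, ℂ)) : ip φ 0 = 0 := by
  rw [ip, map_zero, inner_zero_right]

theorem ip_conj (φ ψ : 𝓢(Plane, ℂ)) : (starRingEnd ℂ) (ip φ ψ) = ip ψ φ := inner_conj_symm _ _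

theorem ip_adag_left (φ ψ : 𝓢(Plane, ℂ)) : ip (adag φ) ψ = ip φ (a ψ) := inner_a φ ψ

theorem ip_a_left (φ ψ : 𝓢(Plane, ℂ)) : ip (a φ) ψ = ip φ (adag ψ) := inner_adag φ ψ

theorem ip_bdag_left (φ ψ : 𝓢(Plane, ℂ)) : ip (bdag φ) ψ = ip φ (b ψ) := inner_b φ ψ

theorem ip_b_left (φ ψ : 𝓢(Plane, ℂ)) : ip (b φ) ψ = ip φ (bdag ψ) := inner_bdag φ ψ

theorem ip_state_zero_zero (k l : ℕ) :
    ip (state 0 k) (state 0 l) = if k = l then (k.factorial : ℂ) else 0 := by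
  induction k generalizing l with
  | zero =>
    cases l with
    | zero =>
      have : state 0 0 = vac := rfl
      rw [if_pos rfl, this, ip, inner_self_eq_norm_sq_to_K, norm_vac]
      simp
    | succ l =>
      rw [← ip_conj, ← bdag_state, ip_bdag_left, b_state_zero, ip_zero_right]
      simp
  | succ k ih =>
    rw [← bdag_state, ip_bdag_left]
    cases l with
    | zero => rw [b_state_zero, ip_zero_right]; simp
    | succ l =>
      rw [b_state_succ, ip_smul_right, ih]
      simp only [add_left_inj]
      split_ifs with h
      · rw [h, Nat.factorial_succ]; push_cast; ring
      · ring

theorem ip_state (n k m l : ℕ) : ip (state n k) (state m l)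
    = if n = m ∧ k = l then (n.factorial * k.factorial : ℂ) else 0 := by
  induction n generalizing m with
  | zero =>
    cases m with
    | zero => rw [ip_state_zero_zero]; simp
    | succ m => rw [← ip_conj, ← adag_state, ip_adag_left, a_state_zero, ip_zero_right]; simp
  | succ n ih =>
    rw [← adag_state, ip_adag_left]
    cases m with
    | zero => rw [a_state_zero, ip_zero_right]; simp
    | succ m =>
      rw [a_state_succ, ip_smul_right, ih]
      simp only [add_left_inj]
      split_ifs with h
      · rw [h.1, Nat.factorial_succ]; push_cast; ring
      · ring

theorem a_G (φ : 𝓢(Plane, ℂ)) : a (G φ) = G (bdag φ) := LinearMap.congr_fun a_mul_G φ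

theorem b_G (φ : 𝓢(Plane, ℂ)) : b (G φ) = G (adag φ) := LinearMap.congr_fun b_mul_G φ

theorem adag_G (φ : 𝓢(Plane, ℂ)) : adag (G φ) = (2 : ℂ) • G (adag φ) - G (b φ) := by
  have h := LinearMap.congr_fun adag_mul_G φ
  rw [Module.End.mul_apply, Module.End.mul_apply] at h
  rw [h, LinearMap.sub_apply, map_sub, LinearMap.smul_apply, map_smul]

theorem bdag_G (φ : 𝓢(Plane, ℂ)) : bdag (G φ) = (2 : ℂ) • G (bdag φ) - G (a φ) := by
  have h := LinearMap.congr_fun bdag_mul_G φ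
  rw [Module.End.mul_apply, Module.End.mul_apply] at h
  rw [h, LinearMap.sub_apply, map_sub, LinearMap.smul_apply, map_smul]

/-- Since `a` kills the vacuum, its adjoint `adag` applied to `G φ` is orthogonal to it; now move
`adag` through `G`. -/
theorem two_mul_ip_vac_G_adag (φ : 𝓢(Plane, ℂ)) :
    2 * ip vac (G (adag φ)) = ip vac (G (b φ)) := by
  have h : ip (a vac) (G φ) = 0 := by rw [a_vac, ip_zero_left]
  rw [ip_a_left, adag_G, ip_sub_right, ip_smul_right] at h
  exact sub_eq_zero.1 h

theorem two_mul_ip_vac_G_bdag (φ : 𝓢(Plane, ℂ)) :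
    2 * ip vac (G (bdag φ)) = ip vac (G (a φ)) := by
  have h : ip (b vac) (G φ) = 0 := by rw [b_vac, ip_zero_left]
  rw [ip_b_left, bdag_G, ip_sub_right, ip_smul_right] at h
  exact sub_eq_zero.1 h

/-- Under the vacuum expectation, a raising operator of one kind may be traded for half a lowering
operator of the other kind. Quanta therefore disappear in pairs, one of each kind, with a factor
(p+1)/2 each time; an unpaired quantum gives zero. -/
theorem ip_vac_G_state (p q : ℕ) : ip vac (G (state p q))
    = if p = q then (p.factorial : ℂ) / 2 ^ p * ip vac (G vac) else 0 := by
  induction p generalizing q with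
  | zero =>
    cases q with
    | zero => simp [state]
    | succ q =>
      have h := two_mul_ip_vac_G_bdag (state 0 q)
      rw [bdag_state, a_state_zero, map_zero, ip_zero_right] at h
      simpa using h
  | succ p ih =>
    cases q with
    | zero =>
      have h := two_mul_ip_vac_G_adag (state p 0)
      rw [adag_state, b_state_zero, map_zero, ip_zero_right] at h
      simpa using h
    | succ q =>
      have h := two_mul_ip_vac_G_bdag (state (p + 1) q)
      rw [bdag_state, a_state_succ, map_smul, ip_smul_right, ih] at h
      simp only [add_left_inj]
      split_ifs at h ⊢ with hpq
      · rw [Nat.factorial_succ, pow_succ]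
        push_cast
        linear_combination h / 2
      · simpa using h

/-- Each `adag` on the left becomes `a` in front of `G`, hence `bdag` behind it; likewise each
`bdag` becomes `adag`. The two kinds of quanta are exchanged. -/
theorem ip_state_G_state (n j m k : ℕ) : ip (state n j) (G (state m k))
    = ip vac (G (state (m + j) (k + n))) := by
  induction n generalizing k with
  | succ n ih => rw [← adag_state, ip_adag_left, a_G, bdag_state, ih]; congr 3; ring
  | zero =>
    induction j generalizing m with
    | zero => rfl
    | succ j ih => rw [← bdag_state, ip_bdag_left, b_G, adag_state, ih]; congr 3; ring

end Landau

/-! ### Completeness of the states -/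

open MeasureTheory in
/-- An integrable function with vanishing Fourier transform vanishes almost everywhere. -/
theorem MeasureTheory.Integrable.ae_eq_zero_of_fourier_eq_zero {V : Type*} [NormedAddCommGroup V]
    [InnerProductSpace ℝ V] [FiniteDimensional ℝ V] [MeasurableSpace V] [BorelSpace V]
    {h : V → ℂ} (hh : Integrable h) (hF : ∀ w, FourierTransform.fourier h w = 0) :
    ∀ᵐ x, h x = 0 := by
  refine ae_eq_zero_of_integral_contDiff_smul_eq_zero hh.locallyIntegrable fun g hg hs => ?_
  let φ : 𝓢(V, ℂ) := SchwartzMap.postcompCLM Complex.ofRealCLM (hs.toSchwartzMap hg)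
  -- Writing the test function as a Fourier transform allows the transform to be shifted onto `h`.
  let χ : 𝓢(V, ℂ) := FourierTransformInv.fourierInv φ
  have hχ : FourierTransform.fourier (χ : V → ℂ) = φ := by
    rw [← SchwartzMap.fourier_coe, FourierTransform.fourier_fourierInv_eq]
  have key : ∫ x, FourierTransform.fourier (χ : V → ℂ) x • h x
      = ∫ x, χ x • FourierTransform.fourier h x := by
    simpa using! VectorFourier.integral_fourierIntegral_smul_eq_flip (L := innerₗ V)
      Real.continuous_fourierChar continuous_inner χ.integrable hh
  rw [hχ] at key
  simp only [hF, smul_zero, integral_zero] at key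
  rw [← key]
  refine integral_congr_ae (Filter.Eventually.of_forall fun x => ?_)
  exact (RCLike.real_smul_eq_coe_smul (K := ℂ) (g x) (h x))

namespace Landau

/-- The span of all the states. -/
def stateSpan : Submodule ℂ 𝓢(Plane, ℂ) :=
  Submodule.span ℂ (Set.range fun p : ℕ × ℕ => state p.1 p.2)

theorem state_mem_stateSpan (n k : ℕ) : state n k ∈ stateSpan :=
  Submodule.subset_span ⟨(n, k), rfl⟩

theorem map_mem_stateSpan {T : Module.End ℂ 𝓢(Plane, ℂ)}
    (hT : ∀ n k, T (state n k) ∈ stateSpan) {φ : 𝓢(Plane, ℂ)} (hφ : φ ∈ stateSpan) :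
    T φ ∈ stateSpan := by
  have : stateSpan ≤ stateSpan.comap T := by
    refine Submodule.span_le.2 ?_
    rintro _ ⟨p, rfl⟩
    exact hT _ _
  exact this hφ

theorem adag_mem_stateSpan {φ : 𝓢(Plane, ℂ)} (hφ : φ ∈ stateSpan) : adag φ ∈ stateSpan :=
  map_mem_stateSpan (fun n k => adag_state n k ▸ state_mem_stateSpan _ _) hφ

theorem bdag_mem_stateSpan {φ : 𝓢(Plane, ℂ)} (hφ : φ ∈ stateSpan) : bdag φ ∈ stateSpan :=
  map_mem_stateSpan (fun n k => bdag_state n k ▸ state_mem_stateSpan _ _) hφ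

theorem a_mem_stateSpan {φ : 𝓢(Plane, ℂ)} (hφ : φ ∈ stateSpan) : a φ ∈ stateSpan := by
  refine map_mem_stateSpan (fun n k => ?_) hφ
  cases n with
  | zero => rw [a_state_zero]; exact zero_mem _
  | succ n => rw [a_state_succ]; exact Submodule.smul_mem _ _ (state_mem_stateSpan _ _)

theorem b_mem_stateSpan {φ : 𝓢(Plane, ℂ)} (hφ : φ ∈ stateSpan) : b φ ∈ stateSpan := by
  refine map_mem_stateSpan (fun n k => ?_) hφ
  cases k with
  | zero => rw [b_state_zero]; exact zero_mem _
  | succ k => rw [b_state_succ]; exact Submodule.smul_mem _ _ (state_mem_stateSpan _ _)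

/-- The two brackets are `Z` and `Zdag`, multiplications by conjugate complex coordinates. So the
span of the states is stable under multiplication by polynomials. -/
theorem X_zero_eq : X 0 = (-(Complex.I * s)) • ((adag - b) - (a - bdag)) := by
  simp only [b, bdag, sub_sub_cancel, Z, Zdag]
  have h := s_mul_s
  match_scalars
  · linear_combination (2 * Complex.I ^ 2) * h + Complex.I_sq
  · ring

theorem X_one_eq : X 1 = s • ((adag - b) + (a - bdag)) := by
  simp only [b, bdag, sub_sub_cancel, Z, Zdag]
  have h := s_mul_s
  match_scalars
  · linear_combination (2 * Complex.I ^ 2) * h + Complex.I_sq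
  · ring

theorem X_mem_stateSpan (j : Fin 2) {φ : 𝓢(Plane, ℂ)} (hφ : φ ∈ stateSpan) :
    X j φ ∈ stateSpan := by
  have h1 := sub_mem (adag_mem_stateSpan hφ) (b_mem_stateSpan hφ)
  have h2 := sub_mem (a_mem_stateSpan hφ) (bdag_mem_stateSpan hφ)
  fin_cases j
  · change X 0 φ ∈ stateSpan
    rw [X_zero_eq]
    exact Submodule.smul_mem _ _ (sub_mem h1 h2)
  · change X 1 φ ∈ stateSpan
    rw [X_one_eq]
    exact Submodule.smul_mem _ _ (add_mem h1 h2)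

theorem ground_mem_stateSpan : ground ∈ stateSpan := by
  have hn : ((‖incl ground‖⁻¹ : ℝ) : ℂ) ≠ 0 := by
    intro h
    have := norm_vac
    rw [vac, h, zero_smul, map_zero, norm_zero] at this
    exact zero_ne_one this
  exact (Submodule.smul_mem_iff _ hn).1 (state_mem_stateSpan 0 0)

/-- Multiplication by the linear form `⟨q, ξ⟩`. -/
def innerMul (ξ : Plane) : Module.End ℂ 𝓢(Plane, ℂ) := (ξ 0 : ℂ) • X 0 + (ξ 1 : ℂ) • X 1

theorem innerMul_apply (ξ : Plane) (φ : 𝓢(Plane, ℂ)) (q : Plane) :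
    innerMul ξ φ q = ((inner ℝ q ξ : ℝ) : ℂ) * φ q := by
  have : (inner ℝ q ξ : ℝ) = ξ 0 * q 0 + ξ 1 * q 1 := by
    rw [PiLp.inner_apply, Fin.sum_univ_two]
    rfl
  rw [this]
  simp [innerMul, X_apply]
  ring

theorem innerMul_pow_apply (ξ : Plane) (n : ℕ) (φ : 𝓢(Plane, ℂ)) (q : Plane) :
    (innerMul ξ ^ n) φ q = ((inner ℝ q ξ : ℝ) : ℂ) ^ n * φ q := by
  induction n with
  | zero => simp
  | succ n ih =>
    rw [pow_succ', Module.End.mul_apply, innerMul_apply, ih, pow_succ']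
    ring

theorem innerMul_pow_mem_stateSpan (ξ : Plane) (n : ℕ) :
    (innerMul ξ ^ n) ground ∈ stateSpan := by
  induction n with
  | zero => exact ground_mem_stateSpan
  | succ n ih =>
    rw [pow_succ', Module.End.mul_apply]
    exact add_mem (Submodule.smul_mem _ _ (X_mem_stateSpan 0 ih))
      (Submodule.smul_mem _ _ (X_mem_stateSpan 1 ih))

theorem inner_incl_left (φ : 𝓢(Plane, ℂ)) (f : L2) :
    inner ℂ (incl φ) f = ∫ q, f q * (starRingEnd ℂ) (φ q) := by
  rw [MeasureTheory.L2.inner_def]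
  refine MeasureTheory.integral_congr_ae ?_
  filter_upwards [φ.coeFn_toLp 2 MeasureTheory.volume] with q h1
  have e1 : (incl φ : Plane → ℂ) q = φ q := h1
  rw [e1]
  exact RCLike.inner_apply _ _

theorem inner_incl_eq_zero_of_mem_stateSpan {f : L2}
    (hf : ∀ n k, inner ℂ (incl (state n k)) f = 0) {φ : 𝓢(Plane, ℂ)} (hφ : φ ∈ stateSpan) :
    inner ℂ (incl φ) f = 0 := by
  induction hφ using Submodule.span_induction with
  | mem x hx => obtain ⟨p, rfl⟩ := hx; exact hf _ _
  | zero => rw [map_zero, inner_zero_left]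
  | add x y _ _ hx hy => rw [map_add, inner_add_left, hx, hy, add_zero]
  | smul c x _ hx => rw [map_smul, inner_smul_left, hx, mul_zero]

theorem integral_mul_pow_mul_ground_eq_zero {f : L2}
    (hf : ∀ n k, inner ℂ (incl (state n k)) f = 0) (ξ : Plane) (n : ℕ) :
    ∫ q, ((inner ℝ q ξ : ℝ) : ℂ) ^ n * (f q * ground q) = 0 := by
  rw [← inner_incl_eq_zero_of_mem_stateSpan hf (innerMul_pow_mem_stateSpan ξ n), inner_incl_left]
  congr 1
  ext q
  rw [innerMul_pow_apply, map_mul, map_pow, Complex.conj_ofReal, ground, expSq_apply,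
    Complex.conj_ofReal]
  ring

/-- Half of the exponent of `ground` absorbs the exponential, and the remaining exp(-|q|²/8) is
still in L² and pairs with `f`. The constant 2R² comes from (|q| - 4R)² ≥ 0. -/
theorem integrable_exp_mul_ground (f : L2) (R : ℝ) :
    MeasureTheory.Integrable (fun q : Plane => Real.exp (R * ‖q‖) * ‖f q * ground q‖) := by
  have h1 : MeasureTheory.Integrable
      (fun q : Plane => f q * expSq (1 / 8) (by norm_num) q) :=
    (MeasureTheory.Lp.memLp f).integrable_mul ((expSq (1 / 8) (by norm_num)).memLp 2)
  refine MeasureTheory.Integrable.mono' (h1.norm.const_mul (Real.exp (2 * R ^ 2))) ?_ ?_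
  · refine MeasureTheory.AEStronglyMeasurable.mul ?_ ?_
    · exact Continuous.aestronglyMeasurable (by fun_prop)
    · exact ((MeasureTheory.Lp.aestronglyMeasurable f).mul
        ground.continuous.aestronglyMeasurable).norm
  · refine Filter.Eventually.of_forall fun q => ?_
    simp only [norm_mul, norm_norm, ground, expSq_apply, Complex.norm_real]
    simp only [Real.norm_eq_abs, Real.abs_exp]
    have : Real.exp (R * ‖q‖) * Real.exp (-(1 / 4) * ‖q‖ ^ 2)
        ≤ Real.exp (2 * R ^ 2) * Real.exp (-(1 / 8) * ‖q‖ ^ 2) := by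
      rw [← Real.exp_add, ← Real.exp_add, Real.exp_le_exp]
      nlinarith [sq_nonneg (‖q‖ - 4 * R)]
    calc Real.exp (R * ‖q‖) * (‖f q‖ * Real.exp (-(1 / 4) * ‖q‖ ^ 2))
        = ‖f q‖ * (Real.exp (R * ‖q‖) * Real.exp (-(1 / 4) * ‖q‖ ^ 2)) := by ring
      _ ≤ ‖f q‖ * (Real.exp (2 * R ^ 2) * Real.exp (-(1 / 8) * ‖q‖ ^ 2)) := by gcongr
      _ = _ := by ring

theorem integrable_mul_ground (f : L2) :
    MeasureTheory.Integrable (fun q : Plane => f q * ground q) :=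
  (MeasureTheory.Lp.memLp f).integrable_mul (ground.memLp 2)

/-- Expand the Fourier kernel in its power series. Each term integrates to a moment of `f * ground`,
which vanishes because a polynomial times `ground` is a combination of states. The exponential
integrability above justifies the exchange of sum and integral. -/
theorem fourier_mul_ground_eq_zero {f : L2} (hf : ∀ n k, inner ℂ (incl (state n k)) f = 0)
    (ξ : Plane) : FourierTransform.fourier (fun q : Plane => f q * ground q) ξ = 0 := by
  rw [Real.fourier_eq']
  have hs := MeasureTheory.hasSum_integral_of_dominated_convergence
    (μ := (MeasureTheory.volume : MeasureTheory.Measure Plane))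
    (F := fun (n : ℕ) (q : Plane) =>
      ((((-2 * Real.pi * inner ℝ q ξ : ℝ) : ℂ) * Complex.I) ^ n / n.factorial)
        * (f q * ground q))
    (f := fun q : Plane => Complex.exp (((-2 * Real.pi * inner ℝ q ξ : ℝ) : ℂ) * Complex.I)
      • (f q * ground q))
    (fun n q => (2 * Real.pi * ‖ξ‖ * ‖q‖) ^ n / n.factorial * ‖f q * ground q‖)
    (fun n => ?_) (fun n => ?_) ?_ ?_ ?_
  · refine hs.unique ?_
    convert hasSum_zero with n
    have h := integral_mul_pow_mul_ground_eq_zero hf ξ n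
    have e : ∀ q : Plane, ((((-2 * Real.pi * inner ℝ q ξ : ℝ) : ℂ) * Complex.I) ^ n / n.factorial)
        * (f q * ground q) = (((-2 * Real.pi : ℝ) : ℂ) * Complex.I) ^ n / n.factorial
          * (((inner ℝ q ξ : ℝ) : ℂ) ^ n * (f q * ground q)) := by
      intro q
      push_cast
      ring
    simp only [e]
    rw [MeasureTheory.integral_const_mul, h, mul_zero]
  · refine MeasureTheory.AEStronglyMeasurable.mul ?_
      (integrable_mul_ground f).aestronglyMeasurable
    exact Continuous.aestronglyMeasurable (by fun_prop)
  · refine Filter.Eventually.of_forall fun q => ?_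
    rw [norm_mul, norm_div, norm_pow, norm_mul, Complex.norm_I, mul_one, Complex.norm_real,
      Complex.norm_natCast]
    gcongr
    rw [norm_mul, norm_mul, norm_neg, Real.norm_ofNat, Real.norm_of_nonneg Real.pi_pos.le,
      mul_assoc (2 * Real.pi), mul_comm ‖ξ‖]
    gcongr
    exact norm_inner_le_norm q ξ
  · refine Filter.Eventually.of_forall fun q => ?_
    exact (Real.summable_pow_div_factorial _).mul_right _
  · convert integrable_exp_mul_ground f (2 * Real.pi * ‖ξ‖) using 2 with q
    rw [tsum_mul_right, Real.exp_eq_exp_ℝ, NormedSpace.exp_eq_tsum_div]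
  · refine Filter.Eventually.of_forall fun q => ?_
    refine HasSum.mul_right _ ?_
    rw [Complex.exp_eq_exp_ℂ]
    exact NormedSpace.expSeries_div_hasSum_exp _

theorem eq_zero_of_inner_state_eq_zero {f : L2}
    (hf : ∀ n k, inner ℂ (incl (state n k)) f = 0) : f = 0 := by
  rw [MeasureTheory.Lp.eq_zero_iff_ae_eq_zero]
  filter_upwards [(integrable_mul_ground f).ae_eq_zero_of_fourier_eq_zero
    (fourier_mul_ground_eq_zero hf)] with q hq
  refine (mul_eq_zero.1 hq).resolve_right ?_
  rw [ground, expSq_apply]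
  exact_mod_cast (Real.exp_pos _).ne'

/-! ### Eigenspaces of the closed Hamiltonian -/

theorem hamiltonian_incl (φ : 𝓢(Plane, ℂ)) : ∃ h : incl φ ∈ hamiltonian.domain,
    hamiltonian ⟨incl φ, h⟩ = incl (schwartzHamiltonian φ) := by
  have hle : hamiltonianOnSchwartz ≤ hamiltonian := LinearPMap.le_closure _
  refine ⟨hle.1 (mem_domain_hamiltonianOnSchwartz φ), ?_⟩
  rw [← hamiltonianOnSchwartz_apply]
  exact (hle.2 rfl).symm

theorem incl_state_mem_levelSpace (n k : ℕ) : incl (state n k) ∈ levelSpace n := by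
  obtain ⟨h, h'⟩ := hamiltonian_incl (state n k)
  exact ⟨h, by rw [h', schwartzHamiltonian_state, map_smul]⟩

/-- For fixed `φ` the identity is a closed condition on points of the graph, and it holds on the
graph over Schwartz functions by symmetry. -/
theorem inner_incl_hamiltonian (φ : 𝓢(Plane, ℂ)) {f : L2} (hf : f ∈ hamiltonian.domain) :
    inner ℂ (incl φ) (hamiltonian ⟨f, hf⟩) = inner ℂ (incl (schwartzHamiltonian φ)) f := by
  have hmem : (f, hamiltonian ⟨f, hf⟩) ∈ hamiltonian.graph := LinearPMap.mem_graph _ ⟨f, hf⟩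
  have hcl : hamiltonianOnSchwartz.graph.topologicalClosure = hamiltonian.graph :=
    hamiltonianOnSchwartz_isClosable.graph_closure_eq_closure_graph
  rw [← hcl] at hmem
  have hclosed : IsClosed {p : L2 × L2 |
      inner ℂ (incl φ) p.2 = inner ℂ (incl (schwartzHamiltonian φ)) p.1} :=
    isClosed_eq (by fun_prop) (by fun_prop)
  refine closure_minimal ?_ hclosed hmem
  rintro ⟨x, y⟩ hxy
  obtain ⟨⟨_, ψ, rfl⟩, rfl, h2⟩ := (LinearPMap.mem_graph_iff _).1 hxy
  have h3 : y = incl (schwartzHamiltonian ψ) := h2.symm.trans (hamiltonianOnSchwartz_apply ψ)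
  subst h3
  exact (schwartzHamiltonian_symm φ ψ).symm

/-- Eigenvectors for distinct real eigenvalues are orthogonal. Here `f` is any eigenvector of the
closure, not necessarily Schwartz; this identifies the abstract level with the states of that level.
-/
theorem inner_incl_state_eq_zero {n m : ℕ} (hnm : n ≠ m) (k : ℕ) {f : L2}
    (hf : f ∈ levelSpace m) : inner ℂ (incl (state n k)) f = 0 := by
  obtain ⟨hd, h⟩ := hf
  have key := inner_incl_hamiltonian (state n k) hd
  rw [h, schwartzHamiltonian_state, map_smul, inner_smul_left, inner_smul_right] at key
  have hc : (starRingEnd ℂ) ((n : ℂ) + 1 / 2) = (n : ℂ) + 1 / 2 := by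
    simp [Complex.conj_ofNat]
  rw [hc, ← sub_eq_zero, ← sub_mul] at key
  refine (mul_eq_zero.1 key).resolve_left fun h0 => hnm ?_
  have : (m : ℂ) = n := by linear_combination h0
  exact_mod_cast this.symm

/-! ### The Hilbert basis of normalized states -/

/-- The normalized states, `p = (n, k)` having `n` quanta in the Landau level and `k` in the
guiding centre. -/
def unitState (p : ℕ × ℕ) : L2 :=
  ((√(p.1.factorial * p.2.factorial : ℝ))⁻¹ : ℂ) • incl (state p.1 p.2)

theorem inner_unitState_left (p : ℕ × ℕ) (f : L2) : inner ℂ (unitState p) f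
    = ((√(p.1.factorial * p.2.factorial : ℝ))⁻¹ : ℂ) * inner ℂ (incl (state p.1 p.2)) f := by
  rw [unitState, inner_smul_left, map_inv₀, Complex.conj_ofReal]

theorem orthonormal_unitState : Orthonormal ℂ unitState := by
  rw [orthonormal_iff_ite]
  rintro ⟨n, k⟩ ⟨m, l⟩
  have h := ip_state n k m l
  rw [ip] at h
  rw [inner_unitState_left, unitState, inner_smul_right, h]
  by_cases hp : n = m ∧ k = l
  · obtain ⟨rfl, rfl⟩ := hp
    rw [if_pos ⟨rfl, rfl⟩, if_pos rfl]
    have hpos : (0 : ℝ) < n.factorial * k.factorial := by positivity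
    have h2 : ((n.factorial : ℂ) * k.factorial)
        = ((√(n.factorial * k.factorial : ℝ) : ℝ) : ℂ)
          * ((√(n.factorial * k.factorial : ℝ) : ℝ) : ℂ) := by
      rw [← Complex.ofReal_mul, Real.mul_self_sqrt hpos.le]
      push_cast
      ring
    have h3 : ((√(n.factorial * k.factorial : ℝ) : ℝ) : ℂ) ≠ 0 := by
      exact_mod_cast (Real.sqrt_pos.2 hpos).ne'
    simp only
    rw [h2]
    field_simp
  · rw [if_neg hp, if_neg (by simpa using hp)]
    simp

theorem sqrt_factorial_ne_zero (p : ℕ × ℕ) :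
    ((√(p.1.factorial * p.2.factorial : ℝ) : ℝ) : ℂ) ≠ 0 := by
  have hpos : (0 : ℝ) < p.1.factorial * p.2.factorial := by positivity
  exact_mod_cast (Real.sqrt_pos.2 hpos).ne'

theorem orthogonal_span_unitState : (Submodule.span ℂ (Set.range unitState))ᗮ = ⊥ := by
  rw [Submodule.eq_bot_iff]
  intro f hf
  refine eq_zero_of_inner_state_eq_zero fun n k => ?_
  have h := (Submodule.mem_orthogonal _ f).1 hf (unitState (n, k))
    (Submodule.subset_span ⟨_, rfl⟩)
  rw [inner_unitState_left] at h
  exact (mul_eq_zero.1 h).resolve_left (inv_ne_zero (sqrt_factorial_ne_zero (n, k)))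

/-- The Hilbert basis of `L²(ℝ²)` formed by the normalized states. -/
def stateBasis : HilbertBasis (ℕ × ℕ) ℂ L2 :=
  HilbertBasis.mkOfOrthogonalEqBot orthonormal_unitState orthogonal_span_unitState

theorem stateBasis_apply (p : ℕ × ℕ) : stateBasis p = unitState p := by
  rw [stateBasis, HilbertBasis.coe_mkOfOrthogonalEqBot]

theorem unitState_mem_levelSpace (p : ℕ × ℕ) : unitState p ∈ levelSpace p.1 :=
  Submodule.smul_mem _ _ (incl_state_mem_levelSpace _ _)

theorem inner_unitState_eq_zero {p : ℕ × ℕ} {m : ℕ} (h : p.1 ≠ m) {f : L2}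
    (hf : f ∈ levelSpace m) : inner ℂ (unitState p) f = 0 := by
  rw [inner_unitState_left, inner_incl_state_eq_zero h _ hf, mul_zero]

/-! ### Decay of the normalized matrix elements -/

/-- The vacuum expectation of the gaussian. -/
def vacExp : ℝ := ‖ip vac (G vac)‖

theorem norm_inner_unitState_gaussianOp (n j m k : ℕ) :
    ‖(inner ℂ (unitState (n, j)) (gaussianOp (unitState (m, k))) : ℂ)‖
      = (√(n.factorial * j.factorial : ℝ))⁻¹ * (√(m.factorial * k.factorial : ℝ))⁻¹
        * ‖ip vac (G (state (m + j) (k + n)))‖ := by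
  rw [inner_unitState_left, unitState, map_smul, inner_smul_right, gaussianOp_incl,
    ← ip_state_G_state, ip, norm_mul, norm_mul, norm_inv, norm_inv, Complex.norm_real,
    Complex.norm_real, Real.norm_of_nonneg (Real.sqrt_nonneg _),
    Real.norm_of_nonneg (Real.sqrt_nonneg _), mul_assoc]

theorem inner_unitState_gaussianOp_eq_zero {n j m k : ℕ} (h : m + j ≠ k + n) :
    inner ℂ (unitState (n, j)) (gaussianOp (unitState (m, k))) = 0 := by
  rw [← norm_eq_zero, norm_inner_unitState_gaussianOp, ip_vac_G_state, if_neg h, norm_zero,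
    mul_zero]

theorem sq_norm_inner_unitState_gaussianOp {n j m k : ℕ} (h : m + j = k + n) :
    ‖(inner ℂ (unitState (n, j)) (gaussianOp (unitState (m, k))) : ℂ)‖ ^ 2
      = vacExp ^ 2 * (((m + j).choose n * (m + j).choose m : ℝ) / 4 ^ (m + j)) := by
  rw [norm_inner_unitState_gaussianOp, ip_vac_G_state, if_pos h, norm_mul, norm_div, norm_pow,
    Complex.norm_natCast, Complex.norm_ofNat, ← vacExp, mul_pow, mul_pow, inv_pow, inv_pow,
    Real.sq_sqrt (by positivity), Real.sq_sqrt (by positivity)]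
  have h1 : ((m + j).choose m : ℝ) * m.factorial * j.factorial = (m + j).factorial := by
    have := Nat.add_choose_mul_factorial_mul_factorial m j
    rw [← Nat.choose_symm_add] at this
    exact_mod_cast this
  have h2 : ((m + j).choose n : ℝ) * k.factorial * n.factorial = (m + j).factorial := by
    have := Nat.add_choose_mul_factorial_mul_factorial k n
    rw [← h] at this
    exact_mod_cast this
  have h4 : (4 : ℝ) ^ (m + j) = 2 ^ (m + j) * 2 ^ (m + j) := by
    rw [← mul_pow]; norm_num
  have hf : ∀ i : ℕ, (i.factorial : ℝ) ≠ 0 := fun i => by positivity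
  have e1 : ((m + j).choose m : ℝ) = (m + j).factorial / (m.factorial * j.factorial) := by
    rw [eq_div_iff (mul_ne_zero (hf m) (hf j)), ← mul_assoc, h1]
  have e2 : ((m + j).choose n : ℝ) = (m + j).factorial / (k.factorial * n.factorial) := by
    rw [eq_div_iff (mul_ne_zero (hf k) (hf n)), ← mul_assoc, h2]
  rw [e1, e2, h4]
  have hn := hf n
  have hm := hf m
  have hj := hf j
  have hk := hf k
  field_simp

theorem bracket_pos (z : ℤ) : 0 < bracket z := lt_max_of_lt_left one_pos

theorem norm_inner_unitState_gaussianOp_le (n j m k : ℕ) :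
    ‖(inner ℂ (unitState (n, j)) (gaussianOp (unitState (m, k))) : ℂ)‖
      ≤ 2 * vacExp / bracket ((n : ℤ) - m) := by
  have hb := bracket_pos ((n : ℤ) - m)
  have hv : 0 ≤ vacExp := norm_nonneg _
  by_cases h : m + j = k + n
  · refine abs_le_of_sq_le_sq' ?_ (by positivity) |>.2
    rw [sq_norm_inner_unitState_gaussianOp h, div_pow, mul_pow, le_div_iff₀ (by positivity),
      mul_assoc, mul_comm ((2 : ℝ) ^ 2)]
    refine mul_le_mul_of_nonneg_left ?_ (by positivity)
    rw [div_mul_eq_mul_div, div_le_iff₀ (by positivity)]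
    -- The two values of the maximum correspond to the two binomial bounds, with constants 1 and 2;
    -- both are below the 4 = 2² available.
    rcases max_choice (1 : ℝ) |(((n : ℤ) - m : ℤ) : ℝ)| with h1 | h1
    · rw [bracket, h1]
      have := Nat.choose_mul_choose_le (m + j) n m
      have h4 : (0 : ℝ) < 4 ^ (m + j) := by positivity
      linarith
    · rw [bracket, h1, sq_abs]
      have := Nat.choose_mul_choose_mul_sq_sub_le (m + j) n m (by omega) (by omega)
      have h4 : (0 : ℝ) < 4 ^ (m + j) := by positivity
      push_cast
      linarith
  · rw [inner_unitState_gaussianOp_eq_zero h, norm_zero]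
    positivity

theorem hasSum_inner_unitState_gaussianOp (n j : ℕ) (f : L2) :
    HasSum (fun q => inner ℂ (unitState q) f
      * inner ℂ (unitState (n, j)) (gaussianOp (unitState q)))
      (inner ℂ (unitState (n, j)) (gaussianOp f)) := by
  have h := (stateBasis.hasSum_repr f).mapL ((innerSL ℂ (unitState (n, j))) ∘L gaussianOp)
  simpa [stateBasis_apply, HilbertBasis.repr_apply_apply] using h

/-- In the expansion of `f` only level `m` contributes, and there the selection rule m+j = k+n
leaves at most one k. The condition n ≤ m+j says that this k exists in ℕ. -/
theorem norm_inner_unitState_gaussianOp_le_of_mem {n j m : ℕ} {f : L2} (hf : f ∈ levelSpace m) :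
    ‖(inner ℂ (unitState (n, j)) (gaussianOp f) : ℂ)‖ ≤
      if n ≤ m + j then 2 * vacExp / bracket ((n : ℤ) - m)
        * ‖(inner ℂ (unitState (m, m + j - n)) f : ℂ)‖ else 0 := by
  have hs := hasSum_inner_unitState_gaussianOp n j f
  have hz : ∀ q : ℕ × ℕ, ¬(q.1 = m ∧ m + j = q.2 + n) → inner ℂ (unitState q) f
      * inner ℂ (unitState (n, j)) (gaussianOp (unitState q)) = 0 := by
    rintro ⟨m', k⟩ hq
    by_cases hm : m' = m
    · subst hm
      rw [inner_unitState_gaussianOp_eq_zero (fun h => hq ⟨rfl, h⟩), mul_zero]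
    · rw [inner_unitState_eq_zero hm hf, zero_mul]
  split_ifs with hn
  · have h2 := hasSum_single (f := fun q => inner ℂ (unitState q) f
      * inner ℂ (unitState (n, j)) (gaussianOp (unitState q))) (m, m + j - n) (by
        rintro ⟨m', k⟩ hne
        refine hz _ fun h => hne ?_
        simp only at h
        rw [Prod.mk.injEq]
        omega)
    rw [hs.unique h2, norm_mul, mul_comm]
    gcongr
    exact norm_inner_unitState_gaussianOp_le _ _ _ _
  · have h2 : (fun q => inner ℂ (unitState q) f
      * inner ℂ (unitState (n, j)) (gaussianOp (unitState q))) = fun _ => 0 := by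
      funext q
      exact hz q (by omega)
    rw [h2] at hs
    rw [hs.unique hasSum_zero, norm_zero]

/-! ### From matrix elements to the operator norm -/

theorem levelProj_mem (n : ℕ) (f : L2) : levelProj n f ∈ levelSpace n :=
  Submodule.starProjection_apply_mem _ _

theorem inner_unitState_levelProj (n j : ℕ) (f : L2) :
    inner ℂ (unitState (n, j)) (levelProj n f) = inner ℂ (unitState (n, j)) f := by
  rw [levelProj, ← Submodule.inner_starProjection_left_eq_right,
    Submodule.starProjection_eq_self_iff.2 (unitState_mem_levelSpace (n, j))]

theorem hasSum_sq_norm_inner_unitState (f : L2) :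
    HasSum (fun p => ‖(inner ℂ (unitState p) f : ℂ)‖ ^ 2) (‖f‖ ^ 2) := by
  have h := stateBasis.hasSum_inner_mul_inner f f
  have h2 := (Complex.reCLM : ℂ →L[ℝ] ℝ).hasSum h
  convert h2 using 1
  · funext p
    rw [stateBasis_apply, ← inner_conj_symm f, ← Complex.normSq_eq_conj_mul_self]
    rw [Complex.reCLM_apply, Complex.ofReal_re, Complex.normSq_eq_norm_sq]
  · rw [inner_self_eq_norm_sq_to_K]
    simp [← Complex.ofReal_pow]

/-- By Parseval the squared norm is a sum of squared coefficients, each at most B² times the squared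
coefficient of `f` at the shifted index; the shift is injective, so Bessel's inequality for `f`
finishes. -/
theorem norm_levelProj_gaussianOp_le (n m : ℕ) {f : L2} (hf : f ∈ levelSpace m) :
    ‖levelProj n (gaussianOp f)‖ ≤ 2 * vacExp / bracket ((n : ℤ) - m) * ‖f‖ := by
  have hv : 0 ≤ vacExp := norm_nonneg _
  have hb := bracket_pos ((n : ℤ) - m)
  set B := 2 * vacExp / bracket ((n : ℤ) - m) with hB
  have hB0 : 0 ≤ B := by positivity
  refine abs_le_of_sq_le_sq' ?_ (by positivity) |>.2
  refine hasSum_le_of_sum_le (hasSum_sq_norm_inner_unitState _) fun S => ?_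
  set T := S.filter fun p => p.1 = n ∧ n ≤ m + p.2
  let σ : ℕ × ℕ → ℕ × ℕ := fun p => (m, m + p.2 - n)
  calc ∑ p ∈ S, ‖(inner ℂ (unitState p) (levelProj n (gaussianOp f)) : ℂ)‖ ^ 2
      = ∑ p ∈ T, ‖(inner ℂ (unitState p) (levelProj n (gaussianOp f)) : ℂ)‖ ^ 2 := by
        refine (Finset.sum_subset (Finset.filter_subset _ _) fun p hp hpT => ?_).symm
        obtain ⟨n', j⟩ := p
        by_cases hn : n' = n
        · subst hn
          have h := norm_inner_unitState_gaussianOp_le_of_mem (n := n') (j := j) hf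
          rw [if_neg fun h => hpT (Finset.mem_filter.2 ⟨hp, rfl, h⟩)] at h
          rw [inner_unitState_levelProj, le_antisymm h (norm_nonneg _)]
          norm_num
        · rw [inner_unitState_eq_zero hn (levelProj_mem n _)]
          norm_num
    _ ≤ ∑ p ∈ T, B ^ 2 * ‖(inner ℂ (unitState (σ p)) f : ℂ)‖ ^ 2 := by
        refine Finset.sum_le_sum fun p hp => ?_
        obtain ⟨n', j⟩ := p
        obtain ⟨-, rfl, hn⟩ := Finset.mem_filter.1 hp
        have h := norm_inner_unitState_gaussianOp_le_of_mem (n := n') (j := j) hf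
        rw [if_pos hn] at h
        rw [inner_unitState_levelProj, ← mul_pow]
        gcongr
    _ = B ^ 2 * ∑ q ∈ T.image σ, ‖(inner ℂ (unitState q) f : ℂ)‖ ^ 2 := by
        -- The truncated subtraction in `σ` is injective only because `T` imposes n ≤ m+j.
        have hinj : Set.InjOn σ T := by
          rintro ⟨n₁, j₁⟩ h₁ ⟨n₂, j₂⟩ h₂ h
          have h₁' := (Finset.mem_filter.1 h₁).2
          have h₂' := (Finset.mem_filter.1 h₂).2
          simp only [σ, Prod.mk.injEq] at h h₁' h₂' ⊢
          omega
        rw [Finset.sum_image hinj, Finset.mul_sum]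
    _ ≤ B ^ 2 * ‖f‖ ^ 2 := by
        gcongr
        exact orthonormal_unitState.sum_inner_products_le f
    _ = (B * ‖f‖) ^ 2 := by ring

end Landau

end

theorem mainTheorem5 :
    ∃ c : ℝ, 0 < c ∧ ∀ n m : ℕ,
      ‖Landau.levelProj n ∘L Landau.gaussianOp ∘L Landau.levelProj m‖
        ≤ c / Landau.bracket ((n : ℤ) - (m : ℤ)) := by
  have hv : 0 ≤ Landau.vacExp := norm_nonneg _
  -- The added 1 makes the constant positive without a proof that `vacExp` is nonzero.
  refine ⟨2 * Landau.vacExp + 1, by positivity, fun n m => ?_⟩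
  have hb := Landau.bracket_pos ((n : ℤ) - m)
  refine ContinuousLinearMap.opNorm_le_bound _ (by positivity) fun f => ?_
  calc ‖Landau.levelProj n (Landau.gaussianOp (Landau.levelProj m f))‖
      ≤ 2 * Landau.vacExp / Landau.bracket ((n : ℤ) - m) * ‖Landau.levelProj m f‖ :=
        Landau.norm_levelProj_gaussianOp_le n m (Landau.levelProj_mem m f)
    _ ≤ (2 * Landau.vacExp + 1) / Landau.bracket ((n : ℤ) - m) * ‖f‖ := by
        gcongr
        · linarith
        · exact Submodule.norm_starProjection_apply_le _ f
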